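/- **Setting.** One seller and $n\ge 1$ buyers interact for $T\ge1$ rounds. In round $t$ the valuations $(\mathbf b_t,s_t)\in[0,1]^n\times[0,1]$ are drawn independently from an arbitrary, unknown probability distribution $\mathcal P$ on $[0,1]^{n}\times[0,1]$. Let $\overline b$ be the highest entry of $\mathbf b$ and $\underline b$ the second-highest one (counted with multiplicity; $\underline b=0$ if $n=1$). The learner posts a reserve price $q_t\in[0,1]$, observes the bids $b_{t,i}\ge q_t$, then posts a seller price $p_t\in[0,1]$ and observes $\mathbb I(s_t\le p_t)$. For seller price $p$ and reserve price $q$, $$\mathsf{GFT}_t(p,q)=(\overline b_t-s_t)\,\mathbb I(s_t\le p)\,\mathbb I(\overline b_t\ge q),\qquad \mathsf{Rev}_t(p,q)=(\max\{q,\underline b_t\}-p)\,\mathbb I(s_t\le p)\,\mathbb I(\overline b_t\ge q).$$ A mechanism (a reserve price $q$ and a rule for $p$ that may depend on the bids) has expected gain from trade $\mathsf{GFT}(p,q)=\mathbb E_{\mathcal P}[(\overline b-s)\mathbb I(s\le p)\mathbb I(\overline b\ge q)]$, and $\mathsf{GFT}(q)$ denotes this quantity for the strongly budget-balanced (SBB)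 mechanism $p=\max\{q,\underline b\}$. The regret is $$R_T=T\cdot\max_{q\in[0,1]}\mathsf{GFT}(q)-\sum_{t=1}^T\mathsf{GFT}(q_t),$$ and $R_T^{\rm dep}$ is the same expression with $\mathsf{GFT}(q_t)$ replaced by the expected gain from trade of the mechanism actually deployed in round $t$ (with its own seller price; the expectation is over a fresh $(\mathbf b,s)\sim\mathcal P$ given the past and the learner's current draw). **Algorithm** (parameters $T,T_0,K,\delta$; stopped after round $T$ if $T<2T_0$). 1. *Rounds $1,\dots,T_0$:* post $q_t=0$, $p_t=\underline b_t$. Let $B$ be the multiset of the observed $\overline b_t$. Put $p_0=0$ and, for $k<K$, let $p_{k+1}$ be the largest $q\in B$ with $|\{b\in B:p_k<b<q\}|\le T_0/K$ ($p_{k+1}=1$ if there is none). The grid is $\mathcal B=\{p_0,\dots,p_K\}$. 2. *Rounds $T_0+1,\dots,2T_0$:* draw $U_t$ uniformly from $[0,1]$ and post $p_t=q_t=U_t$. For $q\in\mathcal B$ let $$\overline{\mathsf{GFT}}_1(q)=\frac1{T_0}\sum_{t=T_0+1}^{2T_0}\mathbb I(s_t\le U_t\le\max\{q,\underline b_t\})\,\mathbb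 I(\overline b_t\ge q)+\sqrt{\frac{\ln(2TK/\delta)}{2T_0}},$$ which is computable from the feedback. 3. *Rounds $2T_0+1,\dots,T$:* post a $q_t\in\mathcal B$ that maximizes $\overline{\mathsf{GFT}}_1(q)+\overline{\mathsf{GFT}}_2(q)$ (ties are broken by an arbitrary rule that selects a grid index, given the round number and the set of maximizing indices) and $p_t=\max\{q_t,\underline b_t\}$. Here $\overline{\mathsf{GFT}}_2(q)=1$ if $q$ has not yet been posted in this phase, and otherwise, with $n(q)$ the number of earlier rounds of this phase in which $q$ was posted, $$\overline{\mathsf{GFT}}_2(q)=\frac1{n(q)}\sum_{i}(\overline b_i-\max\{q,\underline b_i\})\,\mathbb I(\overline b_i\ge q,\ s_i\le\max\{q,\underline b_i\})+\sqrt{\frac{\ln(2TK/\delta)}{2n(q)}},$$ the sum being over these rounds. **Theorem.** Let $L=1+\ln(1+T/\delta)$. For all $c>0$ and $a\in\mathbb N$ there are $C\in\mathbb R$ and $m\in\mathbb N$ such that for all $n\ge1$, all $\mathcal P$, all $T\ge1$, all $\delta>0$, all $T_0,K\in\mathbb N$ with $$\frac{T^{2/3}}{cL^a}\le T_0\le cL^aT^{2/3},\qquad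 \frac{T^{1/3}}{cL^a}\le K\le cL^aT^{1/3},$$ and every such tie-breaking rule, the algorithm satisfies: * every mechanism it plays is weakly budget balanced: $\mathsf{Rev}_t(p_t,q_t)\ge0$ for every realization and every $t$; * with probability at least $1-3\delta$ over the valuations and the learner's randomness, $R_T\le C\,L^m\,T^{2/3}$ and $R_T^{\rm dep}\le C\,L^m\,T^{2/3}$; * with probability at least $1-3\delta$ over the valuations, the expectations of $R_T$ and of $R_T^{\rm dep}$ over the learner's randomness (the valuations being held fixed) are both at most $C\,L^m\,T^{2/3}$. Thus, for $T_0=\tilde\Theta(T^{2/3})$ and $K=\tilde\Theta(T^{1/3})$, the regret is $\tilde O(T^{2/3})$, with no assumption on $\mathcal P$. -/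

import Mathlib

open MeasureTheory

noncomputable section

namespace TwoSidedMarket

/-! ### One round of the market -/

/-- Valuations of one round: the `n` buyers' valuations and the seller's valuation. -/
abbrev Valuation (n : ℕ) : Type := (Fin n → unitInterval) × unitInterval

/-- The highest buyer valuation. -/
def highest {n : ℕ} (b : Fin n → unitInterval) : unitInterval := Finset.univ.sup b

/-- The second-highest buyer valuation: the second order statistic, so that it equals the highest
one if two buyers tie at the top, and `0` if there is only one buyer. -/
def secondHighest {n : ℕ} (b : Fin n → unitInterval) : unitInterval :=
  (Finset.univ : Finset (Fin n)).offDiag.sup fun ij => b ij.1 ⊓ b ij.2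

/-- Whoever of the top bidders is declared the winner, `secondHighest` is the highest
valuation among all the other buyers. -/
theorem secondHighest_eq {n : ℕ} (b : Fin n → unitInterval) (i : Fin n) (hi : ∀ j, b j ≤ b i) :
    secondHighest b = (Finset.univ.erase i).sup b := by
  apply le_antisymm
  · refine Finset.sup_le fun x hx => ?_
    have hne : x.1 ≠ x.2 := (Finset.mem_offDiag.mp hx).2.2
    by_cases h1 : x.1 = i
    · have h2 : x.2 ∈ Finset.univ.erase i :=
        Finset.mem_erase.mpr ⟨fun h => hne (h1.trans h.symm), Finset.mem_univ _⟩
      exact inf_le_right.trans (Finset.le_sup (f := b) h2)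
    · have h2 : x.1 ∈ Finset.univ.erase i := Finset.mem_erase.mpr ⟨h1, Finset.mem_univ _⟩
      exact inf_le_left.trans (Finset.le_sup (f := b) h2)
  · refine Finset.sup_le fun j hj => ?_
    have hmem : (j, i) ∈ (Finset.univ : Finset (Fin n)).offDiag :=
      Finset.mem_offDiag.mpr ⟨Finset.mem_univ _, Finset.mem_univ _, (Finset.mem_erase.mp hj).1⟩
    have h := Finset.le_sup (f := fun ij : Fin n × Fin n => b ij.1 ⊓ b ij.2) hmem
    have h' : b j ⊓ b i = b j := inf_eq_left.mpr (hi j)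
    exact h'.symm.le.trans h

/-- Gain from trade of a round with valuations `v`, seller price `p` and reserve price `q`. -/
def gft {n : ℕ} (v : Valuation n) (p q : unitInterval) : ℝ :=
  if v.2 ≤ p ∧ q ≤ highest v.1 then (highest v.1 : ℝ) - (v.2 : ℝ) else 0

/-- Revenue of the mechanism in a round with valuations `v`, seller price `p` and
reserve price `q`. -/
def rev {n : ℕ} (v : Valuation n) (p q : unitInterval) : ℝ :=
  if v.2 ≤ p ∧ q ≤ highest v.1 then ((max q (secondHighest v.1) : unitInterval) : ℝ) - (p : ℝ)
  else 0

/-- Expected gain from trade of a mechanism with reserve price `q` whose seller price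
`p b` may depend on the buyers' valuations `b`. -/
def expGFT {n : ℕ} (P : Measure (Valuation n)) (p : (Fin n → unitInterval) → unitInterval)
    (q : unitInterval) : ℝ :=
  ∫ v, gft v (p v.1) q ∂P

/-- Expected gain from trade of the strongly budget-balanced mechanism with reserve price `q`,
that is, with seller price equal to the buyer's payment. -/
def sbbGFT {n : ℕ} (P : Measure (Valuation n)) (q : unitInterval) : ℝ :=
  expGFT P (fun b => max q (secondHighest b)) q

/-! ### Repeated interaction under asymmetric feedback -/

/-- The bids the mechanism gets to see when it posts the reserve price `q`. -/
def visibleBids {n : ℕ} (q : unitInterval) (b : Fin n → unitInterval) :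
    Fin n → Option unitInterval :=
  fun i => if q ≤ b i then some (b i) else none

/-- Everything the learner knows about one past round: its own two prices, the visible bids,
and whether the seller accepted the price. -/
structure Observation (n : ℕ) where
  reserve : unitInterval
  price : unitInterval
  bids : Fin n → Option unitInterval
  accepted : Bool

/-- A learner. In every round it receives the observations of the past rounds (oldest first) and
a fresh internal random draw; it posts the reserve price, sees the visible bids, and then posts the
seller price. -/
structure Policy (n : ℕ) where
  reserve : List (Observation n) → unitInterval → unitInterval
  price : List (Observation n) → unitInterval → (Fin n → Option unitInterval) → unitInterval

/-- The observations of the rounds `0, …, t - 1`, for valuations `v` and internal draws `u`. -/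
def history {n : ℕ} (π : Policy n) (v : ℕ → Valuation n) (u : ℕ → unitInterval) :
    ℕ → List (Observation n)
  | 0 => []
  | t + 1 =>
    let h := history π v u t
    let q := π.reserve h (u t)
    let p := π.price h (u t) (visibleBids q (v t).1)
    h ++ [⟨q, p, visibleBids q (v t).1, decide ((v t).2 ≤ p)⟩]

/-- The reserve price posted in round `t`. -/
def reserveAt {n : ℕ} (π : Policy n) (v : ℕ → Valuation n) (u : ℕ → unitInterval) (t : ℕ) :
    unitInterval :=
  π.reserve (history π v u t) (u t)

/-- The seller-price rule in force in round `t`, as a function of the buyers' valuations. -/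
def priceRuleAt {n : ℕ} (π : Policy n) (v : ℕ → Valuation n) (u : ℕ → unitInterval) (t : ℕ)
    (b : Fin n → unitInterval) : unitInterval :=
  π.price (history π v u t) (u t) (visibleBids (reserveAt π v u t) b)

/-- The seller price posted in round `t`. -/
def priceAt {n : ℕ} (π : Policy n) (v : ℕ → Valuation n) (u : ℕ → unitInterval) (t : ℕ) :
    unitInterval :=
  priceRuleAt π v u t (v t).1

/-- Regret after `T` rounds against the best fixed reserve price, a round being
valued by the expected gain from trade of the strongly budget-balanced mechanism with the posted
reserve price. -/
def regret {n : ℕ} (P : Measure (Valuation n)) (π : Policy n) (T : ℕ) (v : ℕ → Valuation n)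
    (u : ℕ → unitInterval) : ℝ :=
  T * (⨆ q : unitInterval, sbbGFT P q) - ∑ t ∈ Finset.range T, sbbGFT P (reserveAt π v u t)

/-- Regret after `T` rounds against the best fixed reserve price, a round being
valued by the expected gain from trade of the mechanism that is actually deployed, with its own
seller price. -/
def deployedRegret {n : ℕ} (P : Measure (Valuation n)) (π : Policy n) (T : ℕ)
    (v : ℕ → Valuation n) (u : ℕ → unitInterval) : ℝ :=
  T * (⨆ q : unitInterval, sbbGFT P q)
    - ∑ t ∈ Finset.range T, expGFT P (priceRuleAt π v u t) (reserveAt π v u t)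

/-! ### The algorithm -/

/-- The visible bids with `0` in place of the hidden ones. -/
def filledBids {n : ℕ} (b : Fin n → Option unitInterval) : Fin n → unitInterval :=
  fun i => (b i).getD 0

/-- The point after `p` in the adaptive grid built from the samples `B` (with multiplicity): the
largest sample `q` such that at most `T₀ / K` samples lie strictly between `p` and `q`, or `1` if
there is none. -/
def gridNext (B : List unitInterval) (T₀ K : ℕ) (p : unitInterval) : unitInterval :=
  let cand := B.toFinset.filter fun q =>
    ((B.countP fun b => decide (p < b ∧ b < q) : ℕ) : ℝ) ≤ (T₀ : ℝ) / (K : ℝ)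
  if h : cand.Nonempty then cand.max' h else 1

/-- The points of the adaptive grid; the grid is `{gridPoint B T₀ K k | k ≤ K}`. -/
def gridPoint (B : List unitInterval) (T₀ K : ℕ) : ℕ → unitInterval
  | 0 => 0
  | k + 1 => gridNext B T₀ K (gridPoint B T₀ K k)

/-- The highest bids seen in the first `T₀` rounds. -/
def gridSamples {n : ℕ} (T₀ : ℕ) (h : List (Observation n)) : List unitInterval :=
  (h.take T₀).map fun o => highest (filledBids o.bids)

/-- The `k`-th grid price determined by a history. -/
def arm {n : ℕ} (T₀ K : ℕ) (h : List (Observation n)) (k : ℕ) : unitInterval :=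
  gridPoint (gridSamples T₀ h) T₀ K k

/-- Estimate of the first component of the gain from trade from the rounds `T₀, …, 2 T₀ - 1`.
In these rounds the posted seller price is the uniform draw. -/
def gft1Hat {n : ℕ} (T₀ : ℕ) (h : List (Observation n)) (q : unitInterval) : ℝ :=
  (1 / (T₀ : ℝ)) * (((h.drop T₀).take T₀).map fun o =>
    if o.accepted = true ∧ o.price ≤ max q (secondHighest (filledBids o.bids)) ∧
      q ≤ highest (filledBids o.bids) then (1 : ℝ) else 0).sum

/-- Upper confidence bound on the first component. -/
def gft1Bar {n : ℕ} (T T₀ K : ℕ) (δ : ℝ) (h : List (Observation n)) (q : unitInterval) : ℝ :=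
  gft1Hat T₀ h q + Real.sqrt (Real.log (2 * T * K / δ) / (2 * T₀))

/-- The observations, from round `2 T₀` on, of the rounds in which `q` was the reserve price. -/
def playsOf {n : ℕ} (T₀ : ℕ) (h : List (Observation n)) (q : unitInterval) :
    List (Observation n) :=
  (h.drop (2 * T₀)).filter fun o => decide (o.reserve = q)

/-- Empirical mean of the second component over the rounds in which `q` was played. -/
def gft2Hat {n : ℕ} (T₀ : ℕ) (h : List (Observation n)) (q : unitInterval) : ℝ :=
  (1 / ((playsOf T₀ h q).length : ℝ)) * ((playsOf T₀ h q).map fun o =>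
    if q ≤ highest (filledBids o.bids) ∧ o.accepted = true
      then (highest (filledBids o.bids) : ℝ) - (o.price : ℝ) else 0).sum

/-- Upper confidence bound on the second component; it is `1` as long as `q` has not been
played. -/
def gft2Bar {n : ℕ} (T T₀ K : ℕ) (δ : ℝ) (h : List (Observation n)) (q : unitInterval) : ℝ :=
  if (playsOf T₀ h q).length = 0 then 1
  else gft2Hat T₀ h q + Real.sqrt (Real.log (2 * T * K / δ) / (2 * (playsOf T₀ h q).length))

/-- The optimistic index of a price. -/
def ucbIndex {n : ℕ} (T T₀ K : ℕ) (δ : ℝ) (h : List (Observation n)) (q : unitInterval) : ℝ :=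
  gft1Bar T T₀ K δ h q + gft2Bar T T₀ K δ h q

/-- The (numbers of the) grid prices of maximal optimistic index. -/
def bestArms {n : ℕ} (T T₀ K : ℕ) (δ : ℝ) (h : List (Observation n)) : Finset (Fin (K + 1)) :=
  Finset.univ.filter fun k => ∀ j : Fin (K + 1),
    ucbIndex T T₀ K δ h (arm T₀ K h j) ≤ ucbIndex T T₀ K δ h (arm T₀ K h k)

/-- The reserve price posted after the history `h` with uniform draw `u`; `pick t A` is the element
of `A` that is chosen when the maximizers in round `t` are those in `A`. -/
def algReserve {n : ℕ} (T T₀ K : ℕ) (δ : ℝ)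
    (pick : ℕ → Finset (Fin (K + 1)) → Fin (K + 1))
    (h : List (Observation n)) (u : unitInterval) : unitInterval :=
  if h.length < T₀ then 0
  else if h.length < 2 * T₀ then u
  else arm T₀ K h (pick h.length (bestArms T T₀ K δ h))

/-- The three-phase algorithm for horizon `T`: in the first `T₀` rounds it posts reserve price `0`
and offers the seller the second-highest bid; in the next `T₀` rounds it posts the uniform draw on
both sides; from then on it posts a grid price of maximal index and offers the seller the buyer's
payment. (Hidden bids lie below the reserve price, so they do not affect that payment.) -/
def algorithm (n T T₀ K : ℕ) (δ : ℝ)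
    (pick : ℕ → Finset (Fin (K + 1)) → Fin (K + 1)) : Policy n where
  reserve h u := algReserve T T₀ K δ pick h u
  price h u b :=
    if h.length < T₀ then secondHighest (filledBids b)
    else if h.length < 2 * T₀ then u
    else max (algReserve T T₀ K δ pick h u) (secondHighest (filledBids b))

/-! ### Probability and rates -/

/-- Law of the valuations: independent draws from `P`. -/
def valuationLaw {n : ℕ} (P : Measure (Valuation n)) [IsProbabilityMeasure P] :
    Measure (ℕ → Valuation n) :=
  Measure.infinitePi fun _ => P

/-- Law of the internal randomness of the learner: independent uniform draws from `[0, 1]`. -/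
def learnerLaw : Measure (ℕ → unitInterval) :=
  Measure.infinitePi fun _ => (volume : Measure unitInterval)

/-- The logarithmic factor; powers of it are hidden in the soft-O notation. -/
def logFactor (T : ℕ) (δ : ℝ) : ℝ := 1 + Real.log (1 + T / δ)

/-- `x` is of order `T ^ e` up to the factor `c * (logFactor T δ) ^ a`. -/
def HasOrder (c : ℝ) (a T : ℕ) (δ e x : ℝ) : Prop :=
  (T : ℝ) ^ e / (c * logFactor T δ ^ a) ≤ x ∧ x ≤ c * logFactor T δ ^ a * (T : ℝ) ^ e

end TwoSidedMarket

end

/-!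
A price `q` is compared with the first grid price `r` that is at least `q`: with a higher reserve
price the seller is offered at least as much, so the expected gain from trade of `q` exceeds that
of `r` by at most the probability that the highest bid falls strictly between two consecutive grid
points (`sbbGFT_le_add_measure`). The grid is made such that this gap contains at most `T₀ / K` samples,
and a Hoeffding bound for each pair of possible end points, with these two samples left out,
shows that its probability is `1 / K + Õ(1 / √T₀)` (`sbbGFT_le_coverArm`).

The gain from trade is the sum of the seller's share, which is estimated without bias by a uniform
price, and the buyer's share, which is observed in every round in which the price is posted. If the
index of `r` is never an underestimate (`sbbGFT_le_ucbIndex`) and the indices of the played grid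
prices are not too large (`ucbIndex_le`), each round of the last phase loses at most the widths of
the confidence intervals of the price played, and these add up to `T / √T₀` and `√(K T)` up to
logarithms (`sum_inv_sqrt_count_le`, `regret_le_regretBound`).

Two points need care in the probabilities. First, the bound in expectation over the learner's draws
is derived from the joint bound by Markov's inequality (`measure_compl_integral_le`), with threshold
`1 / K`, which costs `T / K` of regret and a factor `K` in the failure probability. That factor is
available because the level of the algorithm's confidence intervals is only needed for the single
price `r`, so that it leaves a failure probability of order `δ / K`; overestimation is excluded with
wider intervals of negligible failure probability (`measure_not_isGood_le`). Second, the choice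
of the rounds in which a price is played is adaptive. The deviation bounds rest on an exponential
supermartingale (`lintegral_prod_le_one`), stopped once the price has been played a given number of
times (`measure_exists_deviation_le`). Independence enters only through the fact that replacing
the draws of one round by fresh ones preserves the joint law (`isResampling_resample`).
-/

noncomputable section

namespace TwoSidedMarket

/-! ### Concentration for predictable sums -/

section Concentration

variable {Ω E : Type*} [MeasurableSpace Ω] [MeasurableSpace E]

/-- `f` does not depend on the `t`-th draw: replacing it by a fresh one does not change `f`. -/
def Ignores {γ : Type*} (R : ℕ → Ω → E → Ω) (t : ℕ) (f : Ω → γ) : Prop :=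
  ∀ ω x, f (R t ω x) = f ω

/-- `R t ω x` is to be read as `ω` with its `t`-th draw replaced by `x`. If `ω` has law `M` and `x`
is an independent draw from `Q`, the result has law `M` again. This is all that the concentration
bounds use of the independence of the draws. -/
def IsResampling (M : Measure Ω) (Q : Measure E) (R : ℕ → Ω → E → Ω) : Prop :=
  ∀ t, MeasurePreserving (fun z : Ω × E => R t z.1 z.2) (M.prod Q) M

variable {M : Measure Ω} {Q : Measure E} [IsProbabilityMeasure M] [IsProbabilityMeasure Q]
  {R : ℕ → Ω → E → Ω}

/-- A product of nonnegative factors, each of mean at most one given the past, has mean at most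
one. -/
theorem lintegral_prod_le_one (hR : IsResampling M Q R) (g : ℕ → Ω → ENNReal) (S : Finset ℕ)
    (hg : ∀ t ∈ S, Measurable (g t))
    (hpast : ∀ s ∈ S, ∀ t ∈ S, s < t → Ignores R t (g s))
    (hstep : ∀ t ∈ S, ∀ ω, ∫⁻ x, g t (R t ω x) ∂Q ≤ 1) :
    ∫⁻ ω, ∏ t ∈ S, g t ω ∂M ≤ 1 := by
  induction S using Finset.induction_on_max with
  | empty => simp
  | insert a S hlt ih =>
    have haS : a ∉ S := fun h => lt_irrefl _ (hlt a h)
    have hmp := hR a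
    have hmeasS : Measurable fun ω => ∏ t ∈ S, g t ω :=
      Finset.measurable_prod _ fun t ht => hg t (Finset.mem_insert_of_mem ht)
    have hga : Measurable (g a) := hg a (Finset.mem_insert_self _ _)
    calc ∫⁻ ω, ∏ t ∈ insert a S, g t ω ∂M
        = ∫⁻ ω, (∏ t ∈ S, g t ω) * g a ω ∂M := by
          simp_rw [Finset.prod_insert haS, mul_comm]
      _ = ∫⁻ z, (∏ t ∈ S, g t (R a z.1 z.2)) * g a (R a z.1 z.2) ∂(M.prod Q) :=
          (hmp.lintegral_comp (hmeasS.mul hga)).symm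
      _ = ∫⁻ z, (∏ t ∈ S, g t z.1) * g a (R a z.1 z.2) ∂(M.prod Q) := by
          refine lintegral_congr fun z => ?_
          congr 1
          refine Finset.prod_congr rfl fun t ht => ?_
          exact hpast t (Finset.mem_insert_of_mem ht) a (Finset.mem_insert_self _ _) (hlt t ht) _ _
      _ = ∫⁻ ω, ∫⁻ x, (∏ t ∈ S, g t ω) * g a (R a ω x) ∂Q ∂M :=
          lintegral_prod _ ((hmeasS.comp measurable_fst).mul (hga.comp hmp.measurable)).aemeasurable
      _ ≤ ∫⁻ ω, ∏ t ∈ S, g t ω ∂M := by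
          refine lintegral_mono fun ω => ?_
          have hm : Measurable fun x => g a (R a ω x) :=
            hga.comp (hmp.measurable.comp measurable_prodMk_left)
          simp only [lintegral_const_mul _ hm]
          calc (∏ t ∈ S, g t ω) * ∫⁻ x, g a (R a ω x) ∂Q
              ≤ (∏ t ∈ S, g t ω) * 1 := by
                gcongr
                exact hstep a (Finset.mem_insert_self _ _) ω
            _ = _ := mul_one _
      _ ≤ 1 := ih (fun t ht => hg t (Finset.mem_insert_of_mem ht))
          (fun s hs t ht => hpast s (Finset.mem_insert_of_mem hs) t (Finset.mem_insert_of_mem ht))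
          (fun t ht => hstep t (Finset.mem_insert_of_mem ht))

/-- Hoeffding's lemma for a variable with values in `[0, 1]`. -/
theorem lintegral_exp_sub_integral_le_one {X : E → ℝ} (hX : Measurable X)
    (h01 : ∀ x, X x ∈ Set.Icc (0 : ℝ) 1) (l : ℝ) :
    ∫⁻ x, ENNReal.ofReal (Real.exp (l * (X x - ∫ y, X y ∂Q) - l ^ 2 / 8)) ∂Q ≤ 1 := by
  have hsub := ProbabilityTheory.hasSubgaussianMGF_of_mem_Icc (μ := Q) hX.aemeasurable
    (Filter.Eventually.of_forall h01)
  have hle := hsub.mgf_le l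
  have hint := hsub.integrable_exp_mul l
  have hc : (((‖(1 : ℝ) - 0‖₊ / 2) ^ 2 : NNReal) : ℝ) * l ^ 2 / 2 = l ^ 2 / 8 := by
    simp; ring
  rw [hc, ProbabilityTheory.mgf] at hle
  have hexp : ∀ x, Real.exp (l * (X x - ∫ y, X y ∂Q) - l ^ 2 / 8)
      = Real.exp (-(l ^ 2 / 8)) * Real.exp (l * (X x - ∫ y, X y ∂Q)) := fun x => by
    rw [← Real.exp_add]; ring_nf
  simp_rw [hexp]
  rw [← ofReal_integral_eq_lintegral_ofReal (hint.const_mul _)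
    (Filter.Eventually.of_forall fun x => by positivity), integral_const_mul]
  refine ENNReal.ofReal_le_one.mpr ?_
  calc Real.exp (-(l ^ 2 / 8)) * ∫ x, Real.exp (l * (X x - ∫ y, X y ∂Q)) ∂Q
      ≤ Real.exp (-(l ^ 2 / 8)) * Real.exp (l ^ 2 / 8) := by gcongr
    _ = 1 := by rw [← Real.exp_add]; simp

/-- Exponential tail bound for a sum over predictably selected rounds. -/
theorem measure_exp_sum_le (hR : IsResampling M Q R) (S : Finset ℕ)
    (I : ℕ → Ω → Prop) [∀ t ω, Decidable (I t ω)] (Y : ℕ → Ω → ℝ) (m : Ω → ℝ)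
    (hI : ∀ t ∈ S, MeasurableSet {ω | I t ω}) (hY : ∀ t ∈ S, Measurable (Y t)) (hm : Measurable m)
    (hIpast : ∀ s ∈ S, ∀ t ∈ S, s ≤ t → Ignores R t (I s))
    (hYpast : ∀ s ∈ S, ∀ t ∈ S, s < t → Ignores R t (Y s))
    (hmpast : ∀ t ∈ S, Ignores R t m)
    (h01 : ∀ t ∈ S, ∀ ω, Y t ω ∈ Set.Icc (0 : ℝ) 1)
    (hmean : ∀ t ∈ S, ∀ ω, ∫ x, Y t (R t ω x) ∂Q = m ω) (l c : ℝ) :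
    M {ω | c ≤ ∑ t ∈ S with I t ω, (l * (Y t ω - m ω) - l ^ 2 / 8)}
      ≤ ENNReal.ofReal (Real.exp (-c)) := by
  set f : ℕ → Ω → ℝ := fun t ω => if I t ω then l * (Y t ω - m ω) - l ^ 2 / 8 else 0 with hf
  set g : ℕ → Ω → ENNReal := fun t ω => ENNReal.ofReal (Real.exp (f t ω)) with hg
  have hfm : ∀ t ∈ S, Measurable (f t) := fun t ht =>
    Measurable.ite (hI t ht) ((((hY t ht).sub hm).const_mul l).sub_const _) measurable_const
  have hgm : ∀ t ∈ S, Measurable (g t) := fun t ht => (hfm t ht).exp.ennreal_ofReal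
  have hprod : ∀ ω, ∏ t ∈ S, g t ω
      = ENNReal.ofReal (Real.exp (∑ t ∈ S with I t ω, (l * (Y t ω - m ω) - l ^ 2 / 8))) := by
    intro ω
    rw [Finset.sum_filter, Real.exp_sum, ENNReal.ofReal_prod_of_nonneg fun _ _ => by positivity]
  have hone : ∫⁻ ω, ∏ t ∈ S, g t ω ∂M ≤ 1 := by
    refine lintegral_prod_le_one hR g S hgm ?_ ?_
    · intro s hs t ht hst ω x
      simp only [hg, hf, hIpast s hs t ht hst.le ω x, hYpast s hs t ht hst ω x, hmpast t ht ω x]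
    · intro t ht ω
      have h := lintegral_exp_sub_integral_le_one (Q := Q) (X := fun x => Y t (R t ω x))
        ((hY t ht).comp ((hR t).measurable.comp measurable_prodMk_left)) (fun x => h01 t ht _) l
      rw [hmean t ht ω] at h
      simp only [hg, hf, hIpast t ht t ht le_rfl ω _, hmpast t ht ω _]
      by_cases hit : I t ω
      · simpa only [hit, if_true] using h
      · simp [hit]
  have hmk := mul_meas_ge_le_lintegral (μ := M)
    (Finset.measurable_prod S hgm) (ENNReal.ofReal (Real.exp c))
  have hset : {ω | c ≤ ∑ t ∈ S with I t ω, (l * (Y t ω - m ω) - l ^ 2 / 8)}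
      ⊆ {ω | ENNReal.ofReal (Real.exp c) ≤ ∏ t ∈ S, g t ω} := by
    intro ω hω
    simp only [Set.mem_ofPred_eq, hprod] at hω ⊢
    exact ENNReal.ofReal_le_ofReal (Real.exp_le_exp.mpr hω)
  have hpos : ENNReal.ofReal (Real.exp c) ≠ 0 := by simp [Real.exp_pos]
  rw [Real.exp_neg, ENNReal.ofReal_inv_of_pos (Real.exp_pos _),
    ← one_div, ENNReal.le_div_iff_mul_le (Or.inl hpos) (Or.inl ENNReal.ofReal_ne_top), mul_comm]
  exact (mul_le_mul_right (measure_mono hset) _).trans (hmk.trans hone)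

/-- Hoeffding bound for the deviation in direction `σ = ±1` of a sum over predictably selected
rounds, on the event that exactly `n` rounds are selected. -/
theorem measure_count_eq_le (hR : IsResampling M Q R) (S : Finset ℕ)
    (I : ℕ → Ω → Prop) [∀ t ω, Decidable (I t ω)] (Y : ℕ → Ω → ℝ) (m : Ω → ℝ)
    (hI : ∀ t ∈ S, MeasurableSet {ω | I t ω}) (hY : ∀ t ∈ S, Measurable (Y t)) (hm : Measurable m)
    (hIpast : ∀ s ∈ S, ∀ t ∈ S, s ≤ t → Ignores R t (I s))
    (hYpast : ∀ s ∈ S, ∀ t ∈ S, s < t → Ignores R t (Y s))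
    (hmpast : ∀ t ∈ S, Ignores R t m)
    (h01 : ∀ t ∈ S, ∀ ω, Y t ω ∈ Set.Icc (0 : ℝ) 1)
    (hmean : ∀ t ∈ S, ∀ ω, ∫ x, Y t (R t ω x) ∂Q = m ω)
    {σ : ℝ} (hσ : σ ^ 2 = 1) {n : ℕ} (hn : 1 ≤ n) {l : ℝ} (hl : 0 ≤ l) :
    M {ω | (S.filter fun t => I t ω).card = n ∧
        Real.sqrt (n * l / 2) ≤ σ * ∑ t ∈ S with I t ω, (Y t ω - m ω)}
      ≤ ENNReal.ofReal (Real.exp (-l)) := by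
  have hn' : (0 : ℝ) < n := by exact_mod_cast hn
  -- the optimal exponent of the Chernoff bound
  set e : ℝ := Real.sqrt (l / (2 * n)) with he
  have he2 : e ^ 2 = l / (2 * n) := Real.sq_sqrt (by positivity)
  have he0 : 0 ≤ e := Real.sqrt_nonneg _
  have hsq : Real.sqrt (n * l / 2) = n * e := by
    rw [show (n : ℝ) * l / 2 = (n * e) ^ 2 by rw [mul_pow, he2]; field_simp]
    exact Real.sqrt_sq (by positivity)
  refine (measure_mono ?_).trans
    (measure_exp_sum_le hR S I Y m hI hY hm hIpast hYpast hmpast h01 hmean (σ * (4 * e)) l)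
  rintro ω ⟨hcard, hdev⟩
  rw [hsq] at hdev
  simp only [Set.mem_ofPred_eq, Finset.sum_sub_distrib, ← Finset.mul_sum, Finset.sum_const, hcard,
    nsmul_eq_mul]
  simp only [Finset.sum_sub_distrib, Finset.sum_const, hcard, nsmul_eq_mul] at hdev
  have h1 : l = 2 * n * e ^ 2 := by rw [he2]; field_simp
  have h2 : (σ * (4 * e)) ^ 2 / 8 = 2 * e ^ 2 := by rw [mul_pow, hσ]; ring
  rw [h2]
  nlinarith [mul_le_mul_of_nonneg_left hdev he0]

/-- Hoeffding bound, uniform in the horizon `t`, for the average of the `Y s` over the rounds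
`s < t` that satisfy the predictable condition `J`. The number of these rounds is random;
each of its possible values costs one application of the bound for a fixed number. -/
theorem measure_exists_deviation_le (hR : IsResampling M Q R) (a b : ℕ)
    (J : ℕ → Ω → Prop) [∀ t ω, Decidable (J t ω)] (Y : ℕ → Ω → ℝ) (m : Ω → ℝ)
    (hJ : ∀ t ∈ Finset.Ico a b, MeasurableSet {ω | J t ω})
    (hY : ∀ t ∈ Finset.Ico a b, Measurable (Y t)) (hm : Measurable m)
    (hJpast : ∀ s ∈ Finset.Ico a b, ∀ t ∈ Finset.Ico a b, s ≤ t → Ignores R t (J s))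
    (hYpast : ∀ s ∈ Finset.Ico a b, ∀ t ∈ Finset.Ico a b, s < t → Ignores R t (Y s))
    (hmpast : ∀ t ∈ Finset.Ico a b, Ignores R t m)
    (h01 : ∀ t ∈ Finset.Ico a b, ∀ ω, Y t ω ∈ Set.Icc (0 : ℝ) 1)
    (hmean : ∀ t ∈ Finset.Ico a b, ∀ ω, ∫ x, Y t (R t ω x) ∂Q = m ω)
    {σ : ℝ} (hσ : σ ^ 2 = 1) {l : ℝ} (hl : 0 ≤ l) :
    M {ω | ∃ t ≤ b, 1 ≤ ((Finset.Ico a t).filter fun s => J s ω).card ∧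
        Real.sqrt (((Finset.Ico a t).filter fun s => J s ω).card * l / 2)
          ≤ σ * ∑ s ∈ Finset.Ico a t with J s ω, (Y s ω - m ω)}
      ≤ (b - a : ℕ) * ENNReal.ofReal (Real.exp (-l)) := by
  set cnt : ℕ → Ω → ℕ := fun t ω => ((Finset.Ico a t).filter fun s => J s ω).card with hcnt
  have hcntm : ∀ t ≤ b, Measurable (cnt t) := by
    intro t ht
    simp only [hcnt, Finset.card_filter]
    refine Finset.measurable_sum _ fun s hs => ?_
    refine Measurable.ite (hJ s ?_) measurable_const measurable_const
    have := Finset.mem_Ico.mp hs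
    exact Finset.mem_Ico.mpr ⟨this.1, this.2.trans_le ht⟩
  have hcntpast : ∀ s ∈ Finset.Ico a b, ∀ t ∈ Finset.Ico a b, s ≤ t → Ignores R t (cnt s) := by
    intro s hs t ht hst ω x
    have hs' := Finset.mem_Ico.mp hs
    simp only [hcnt]
    congr 1
    refine Finset.filter_congr fun r hr => ?_
    have hr' := Finset.mem_Ico.mp hr
    rw [hJpast r (Finset.mem_Ico.mpr ⟨hr'.1, hr'.2.trans hs'.2⟩) t ht (hr'.2.le.trans hst) ω x]
  -- stop selecting rounds once `n` of them have been selected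
  set I : ℕ → ℕ → Ω → Prop := fun n t ω => J t ω ∧ cnt t ω < n with hI
  have hfix := fun n (hn : 1 ≤ n) =>
    measure_count_eq_le hR (Finset.Ico a b) (I n) Y m
      (fun t ht => (hJ t ht).inter
        (measurableSet_lt (hcntm t (Finset.mem_Ico.mp ht).2.le) measurable_const)) hY hm
      (fun s hs t ht hst ω x => by
        simp only [hI, hJpast s hs t ht hst ω x, hcntpast s hs t ht hst ω x])
      hYpast hmpast h01 hmean hσ hn hl
  have hsub : {ω | ∃ t ≤ b, 1 ≤ cnt t ω ∧
      Real.sqrt (cnt t ω * l / 2) ≤ σ * ∑ s ∈ Finset.Ico a t with J s ω, (Y s ω - m ω)}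
      ⊆ ⋃ n ∈ Finset.Icc 1 (b - a), {ω | ((Finset.Ico a b).filter fun t => I n t ω).card = n ∧
        Real.sqrt (n * l / 2) ≤ σ * ∑ t ∈ Finset.Ico a b with I n t ω, (Y t ω - m ω)} := by
    rintro ω ⟨t, htb, h1, hdev⟩
    have hset : (Finset.Ico a b).filter (fun s => I (cnt t ω) s ω)
        = (Finset.Ico a t).filter fun s => J s ω := by
      ext s
      simp only [hI, Finset.mem_filter, Finset.mem_Ico]
      constructor
      · rintro ⟨⟨has, hsb⟩, hJs, hlt⟩
        refine ⟨⟨has, ?_⟩, hJs⟩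
        by_contra! hts
        refine absurd hlt (not_lt.mpr (Finset.card_le_card ?_))
        exact Finset.filter_subset_filter _ (Finset.Ico_subset_Ico_right hts)
      · rintro ⟨⟨has, hst⟩, hJs⟩
        refine ⟨⟨has, hst.trans_le htb⟩, hJs, Finset.card_lt_card ?_⟩
        refine (Finset.ssubset_iff_of_subset
          (Finset.filter_subset_filter _ (Finset.Ico_subset_Ico_right hst.le))).mpr ⟨s, ?_, ?_⟩
        · simp [has, hst, hJs]
        · simp
    have hle : cnt t ω ≤ b - a := (Finset.card_filter_le _ _).trans (by simp; omega)
    simp only [Set.mem_iUnion, Finset.mem_Icc]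
    refine ⟨cnt t ω, ⟨h1, hle⟩, ?_⟩
    simp only [Set.mem_ofPred_eq]
    rw [hset]
    exact ⟨rfl, hdev⟩
  refine (measure_mono hsub).trans ((measure_biUnion_finset_le _ _).trans ?_)
  refine (Finset.sum_le_sum fun n hn => hfix n (Finset.mem_Icc.mp hn).1).trans ?_
  simp

end Concentration

/-! ### One round: decomposition of the gain from trade -/

section Round

variable {n : ℕ}

theorem secondHighest_le_highest (b : Fin n → unitInterval) : secondHighest b ≤ highest b :=
  Finset.sup_le fun x _ => inf_le_left.trans (Finset.le_sup (f := b) (Finset.mem_univ x.1))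

/-- A bid, replaced by `0` if it is below the reserve price. -/
def threshold (q x : unitInterval) : unitInterval := if q ≤ x then x else 0

theorem threshold_mono (q : unitInterval) : Monotone (threshold q) := by
  intro x y hxy
  unfold threshold
  split_ifs with h1 h2
  · exact hxy
  · exact absurd (h1.trans hxy) h2
  · exact unitInterval.nonneg'
  · exact le_rfl

theorem filledBids_visibleBids (q : unitInterval) (b : Fin n → unitInterval) :
    filledBids (visibleBids q b) = fun i => threshold q (b i) := by
  funext i
  unfold filledBids visibleBids threshold
  split_ifs <;> rfl

theorem threshold_bot (q : unitInterval) : threshold q ⊥ = ⊥ := by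
  unfold threshold
  split_ifs <;> rfl

theorem highest_filledBids (q : unitInterval) (b : Fin n → unitInterval) :
    highest (filledBids (visibleBids q b)) = threshold q (highest b) := by
  rw [filledBids_visibleBids]
  exact (Finset.apply_sup_eq_sup_comp (threshold q) (threshold_mono q).map_sup
    (threshold_bot q)).symm

theorem secondHighest_filledBids (q : unitInterval) (b : Fin n → unitInterval) :
    secondHighest (filledBids (visibleBids q b)) = threshold q (secondHighest b) := by
  rw [filledBids_visibleBids]
  refine Eq.trans ?_ (Finset.apply_sup_eq_sup_comp (threshold q) (threshold_mono q).map_sup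
    (threshold_bot q)).symm
  unfold secondHighest
  congr 1
  funext ij
  exact ((threshold_mono q).map_inf _ _).symm

theorem max_threshold (q x : unitInterval) : max q (threshold q x) = max q x := by
  unfold threshold
  split_ifs with h
  · rfl
  · rw [max_eq_left (le_of_not_ge h), max_eq_left unitInterval.nonneg']

theorem threshold_zero (x : unitInterval) : threshold 0 x = x := by
  simp [threshold]

theorem le_threshold_iff (q x : unitInterval) : q ≤ threshold q x ↔ q ≤ x := by
  unfold threshold
  split_ifs with h
  · rfl
  · refine ⟨fun h0 => h0.trans unitInterval.nonneg', fun h' => absurd h' h⟩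

/-- The estimate of the first component is computable from the visible bids: bids below the posted
reserve price `u` do not matter for whether `u` is at most the payment under the reserve `q`. -/
theorem payment_condition_threshold (u q s h : unitInterval) (hs : s ≤ h) :
    (u ≤ max q (threshold u s) ∧ q ≤ threshold u h) ↔ (u ≤ max q s ∧ q ≤ h) := by
  by_cases hu : u ≤ h
  · have hh : threshold u h = h := if_pos hu
    rw [hh, le_max_iff, le_max_iff, le_threshold_iff]
  · have hus : ¬ u ≤ s := fun h' => hu (h'.trans hs)
    have hh : threshold u h = 0 := if_neg hu
    have hss : threshold u s = 0 := if_neg hus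
    rw [hh, hss, le_max_iff, le_max_iff]
    constructor
    · rintro ⟨h1, h2⟩
      exact absurd (h1.elim (fun h => h.trans (h2.trans unitInterval.nonneg'))
        fun h => h.trans unitInterval.nonneg') hu
    · rintro ⟨h1, h2⟩
      exact absurd (h1.elim (fun h => h.trans h2) fun h => h.trans hs) hu

/-- The part of the gain from trade that lies below the payment, under the strongly
budget-balanced mechanism with reserve price `q`: the seller's share. -/
def sellerShare (v : Valuation n) (q : unitInterval) : ℝ :=
  if v.2 ≤ max q (secondHighest v.1) ∧ q ≤ highest v.1
    then ((max q (secondHighest v.1) : unitInterval) : ℝ) - (v.2 : ℝ) else 0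

/-- The part of the gain from trade that lies above the payment: the winning buyer's share. -/
def buyerShare (v : Valuation n) (q : unitInterval) : ℝ :=
  if q ≤ highest v.1 ∧ v.2 ≤ max q (secondHighest v.1)
    then (highest v.1 : ℝ) - ((max q (secondHighest v.1) : unitInterval) : ℝ) else 0

/-- One-point estimate of the seller's share by means of a price `u`. -/
def sellerShareSample (v : Valuation n) (u q : unitInterval) : ℝ :=
  if v.2 ≤ u ∧ u ≤ max q (secondHighest v.1) ∧ q ≤ highest v.1 then 1 else 0

theorem gft_eq_sellerShare_add_buyerShare (v : Valuation n) (q : unitInterval) :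
    gft v (max q (secondHighest v.1)) q = sellerShare v q + buyerShare v q := by
  unfold gft sellerShare buyerShare
  by_cases h : v.2 ≤ max q (secondHighest v.1) ∧ q ≤ highest v.1
  · rw [if_pos h, if_pos h, if_pos h.symm]
    ring
  · rw [if_neg h, if_neg h, if_neg fun h' => h h'.symm, add_zero]

theorem payment_le_highest {v : Valuation n} {q : unitInterval} (h : q ≤ highest v.1) :
    max q (secondHighest v.1) ≤ highest v.1 :=
  max_le h (secondHighest_le_highest _)

theorem buyerShare_mem_Icc (v : Valuation n) (q : unitInterval) :
    buyerShare v q ∈ Set.Icc (0 : ℝ) 1 := by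
  unfold buyerShare
  split_ifs with h
  · have h1 : ((max q (secondHighest v.1) : unitInterval) : ℝ) ≤ (highest v.1 : ℝ) :=
      payment_le_highest h.1
    have h2 := (highest v.1).2.2
    have h3 := (max q (secondHighest v.1)).2.1
    constructor <;> linarith
  · simp

theorem sellerShareSample_mem_Icc (v : Valuation n) (u q : unitInterval) :
    sellerShareSample v u q ∈ Set.Icc (0 : ℝ) 1 := by
  unfold sellerShareSample
  split_ifs <;> simp

theorem gft_le_one (v : Valuation n) (p q : unitInterval) : gft v p q ≤ 1 := by
  unfold gft
  split_ifs
  · have h2 := (highest v.1).2.2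
    have h3 := v.2.2.1
    linarith
  · norm_num

theorem gft_nonneg {v : Valuation n} {p q : unitInterval} (h : q ≤ highest v.1 → p ≤ highest v.1) :
    0 ≤ gft v p q := by
  unfold gft
  split_ifs with h1
  · have : (v.2 : ℝ) ≤ (highest v.1 : ℝ) := h1.1.trans (h h1.2)
    linarith
  · exact le_rfl

/-- Integrating a uniform price over the interval between the seller's valuation and the payment
gives the seller's share. -/
theorem integral_sellerShareSample (v : Valuation n) (q : unitInterval) :
    ∫ u, sellerShareSample v u q ∂(volume : Measure unitInterval) = sellerShare v q := by
  unfold sellerShareSample sellerShare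
  by_cases h : v.2 ≤ max q (secondHighest v.1) ∧ q ≤ highest v.1
  · have h1 : ∀ u : unitInterval,
        (if v.2 ≤ u ∧ u ≤ max q (secondHighest v.1) ∧ q ≤ highest v.1 then (1 : ℝ) else 0)
          = (Set.Icc v.2 (max q (secondHighest v.1))).indicator 1 u := fun u => by
      simp [Set.indicator_apply, h.2]
    simp_rw [h1]
    rw [integral_indicator_one measurableSet_Icc, if_pos h, measureReal_def,
      unitInterval.volume_Icc, ENNReal.toReal_ofReal]
    exact sub_nonneg.mpr h.1
  · rw [if_neg h]
    have h1 : ∀ u : unitInterval,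
        (if v.2 ≤ u ∧ u ≤ max q (secondHighest v.1) ∧ q ≤ highest v.1 then (1 : ℝ) else 0) = 0 :=
      fun u => if_neg fun h' => h ⟨h'.1.trans h'.2.1, h'.2.2⟩
    simp_rw [h1]
    exact integral_zero _ _

theorem measurable_highest : Measurable (highest : (Fin n → unitInterval) → unitInterval) :=
  (Continuous.finset_sup_apply fun i _ => continuous_apply i).measurable

theorem measurable_secondHighest :
    Measurable (secondHighest : (Fin n → unitInterval) → unitInterval) :=
  (Continuous.finset_sup_apply fun i _ =>
    (continuous_apply i.1).inf (continuous_apply i.2)).measurable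

variable {α : Type*} [MeasurableSpace α] {v : α → Valuation n} {q u : α → unitInterval}

theorem measurable_payment (hv : Measurable v) (hq : Measurable q) :
    Measurable fun x => max (q x) (secondHighest (v x).1) :=
  hq.max (measurable_secondHighest.comp hv.fst)

theorem measurable_highest_comp (hv : Measurable v) : Measurable fun x => highest (v x).1 :=
  measurable_highest.comp hv.fst

theorem measurableSet_trade (hv : Measurable v) (hq : Measurable q) :
    MeasurableSet {x | (v x).2 ≤ max (q x) (secondHighest (v x).1) ∧ q x ≤ highest (v x).1} := by
  have h1 : MeasurableSet {x | (v x).2 ≤ max (q x) (secondHighest (v x).1)} :=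
    measurableSet_le hv.snd (measurable_payment hv hq)
  have h2 : MeasurableSet {x | q x ≤ highest (v x).1} :=
    measurableSet_le hq (measurable_highest_comp hv)
  exact h1.inter h2

theorem measurable_sellerShare (hv : Measurable v) (hq : Measurable q) :
    Measurable fun x => sellerShare (v x) (q x) :=
  Measurable.ite (measurableSet_trade hv hq)
    ((measurable_payment hv hq).subtype_val.sub hv.snd.subtype_val) measurable_const

theorem measurable_buyerShare (hv : Measurable v) (hq : Measurable q) :
    Measurable fun x => buyerShare (v x) (q x) := by
  refine Measurable.ite ?_ ((measurable_highest_comp hv).subtype_val.sub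
    (measurable_payment hv hq).subtype_val) measurable_const
  simp_rw [and_comm (a := _ ≤ highest _)]
  exact measurableSet_trade hv hq

theorem measurable_sellerShareSample (hv : Measurable v) (hu : Measurable u) (hq : Measurable q) :
    Measurable fun x => sellerShareSample (v x) (u x) (q x) := by
  have h1 : MeasurableSet {x | (v x).2 ≤ u x} := measurableSet_le hv.snd hu
  have h2 : MeasurableSet {x | u x ≤ max (q x) (secondHighest (v x).1)} :=
    measurableSet_le hu (measurable_payment hv hq)
  have h3 : MeasurableSet {x | q x ≤ highest (v x).1} :=
    measurableSet_le hq (measurable_highest_comp hv)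
  exact Measurable.ite (h1.inter (h2.inter h3)) measurable_const measurable_const

end Round

/-! ### Expected gain from trade -/

section Expected

variable {n : ℕ} (P : Measure (Valuation n)) [IsProbabilityMeasure P]

/-- Expected seller's share. -/
def expSellerShare (q : unitInterval) : ℝ := ∫ v, sellerShare v q ∂P

/-- Expected buyer's share. -/
def expBuyerShare (q : unitInterval) : ℝ := ∫ v, buyerShare v q ∂P

theorem sellerShare_mem_Icc (v : Valuation n) (q : unitInterval) :
    sellerShare v q ∈ Set.Icc (0 : ℝ) 1 := by
  unfold sellerShare
  split_ifs with h
  · have h1 : (v.2 : ℝ) ≤ ((max q (secondHighest v.1) : unitInterval) : ℝ) := h.1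
    have h2 := v.2.2.1
    have h3 := (max q (secondHighest v.1)).2.2
    constructor <;> linarith
  · simp

theorem integrable_sellerShare (q : unitInterval) : Integrable (fun v => sellerShare v q) P :=
  Integrable.of_mem_Icc 0 1 (measurable_sellerShare measurable_id measurable_const).aemeasurable
    (Filter.Eventually.of_forall fun v => sellerShare_mem_Icc v q)

theorem integrable_buyerShare (q : unitInterval) : Integrable (fun v => buyerShare v q) P :=
  Integrable.of_mem_Icc 0 1 (measurable_buyerShare measurable_id measurable_const).aemeasurable
    (Filter.Eventually.of_forall fun v => buyerShare_mem_Icc v q)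

theorem sbbGFT_eq_add (q : unitInterval) :
    sbbGFT P q = expSellerShare P q + expBuyerShare P q := by
  unfold sbbGFT expGFT expSellerShare expBuyerShare
  simp_rw [gft_eq_sellerShare_add_buyerShare]
  exact integral_add (integrable_sellerShare P q) (integrable_buyerShare P q)

/-- The one-point estimate is unbiased. -/
theorem integral_sellerShareSample_prod (q : unitInterval) :
    ∫ x : Valuation n × unitInterval, sellerShareSample x.1 x.2 q ∂(P.prod volume)
      = expSellerShare P q := by
  rw [integral_prod]
  · simp_rw [integral_sellerShareSample]
    rfl
  · exact Integrable.of_mem_Icc 0 1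
      (measurable_sellerShareSample measurable_fst measurable_snd measurable_const).aemeasurable
      (Filter.Eventually.of_forall fun x => sellerShareSample_mem_Icc _ _ _)

theorem integral_buyerShare_prod (q : unitInterval) :
    ∫ x : Valuation n × unitInterval, buyerShare x.1 q ∂(P.prod volume) = expBuyerShare P q := by
  rw [integral_prod]
  · simp [expBuyerShare]
  · exact Integrable.of_mem_Icc 0 1
      (measurable_buyerShare measurable_fst measurable_const).aemeasurable
      (Filter.Eventually.of_forall fun x => buyerShare_mem_Icc _ _)

omit [IsProbabilityMeasure P] in
theorem expGFT_nonneg (p : (Fin n → unitInterval) → unitInterval) (q : unitInterval)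
    (h : ∀ b, q ≤ highest b → p b ≤ highest b) : 0 ≤ expGFT P p q :=
  integral_nonneg fun v => gft_nonneg (h v.1)

omit [IsProbabilityMeasure P] in
theorem sbbGFT_nonneg (q : unitInterval) : 0 ≤ sbbGFT P q :=
  expGFT_nonneg P _ q fun b h => payment_le_highest (v := (b, 0)) h

theorem expBuyerShare_le_one (q : unitInterval) : expBuyerShare P q ≤ 1 := by
  calc expBuyerShare P q ≤ ∫ _, (1 : ℝ) ∂P :=
        integral_mono (integrable_buyerShare P q) (integrable_const _)
          fun v => (buyerShare_mem_Icc v q).2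
    _ = 1 := by simp

theorem integrable_sbb (q : unitInterval) :
    Integrable (fun v : Valuation n => gft v (max q (secondHighest v.1)) q) P := by
  simp_rw [gft_eq_sellerShare_add_buyerShare]
  exact (integrable_sellerShare P q).add (integrable_buyerShare P q)

theorem sbbGFT_le_one (q : unitInterval) : sbbGFT P q ≤ 1 := by
  calc sbbGFT P q ≤ ∫ _, (1 : ℝ) ∂P :=
        integral_mono (integrable_sbb P q) (integrable_const _) fun v => gft_le_one _ _ _
    _ = 1 := by simp

theorem measurable_expSellerShare : Measurable (expSellerShare P) :=
  ((measurable_sellerShare (n := n) measurable_snd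
    measurable_fst).stronglyMeasurable.integral_prod_right (ν := P)).measurable

theorem measurable_expBuyerShare : Measurable (expBuyerShare P) :=
  ((measurable_buyerShare (n := n) measurable_snd
    measurable_fst).stronglyMeasurable.integral_prod_right (ν := P)).measurable

/-- Lowering the reserve price from a higher level `r` to `q` gains at most the trades whose
highest bid lies in `[q, r)`: with a higher reserve price, the seller is
offered at least as much. -/
theorem sbbGFT_le_add_measure {q r : unitInterval} (hqr : q ≤ r) {A : Set (Valuation n)}
    (hA : MeasurableSet A) (hsub : ∀ v : Valuation n, q ≤ highest v.1 → highest v.1 < r → v ∈ A) :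
    sbbGFT P q ≤ sbbGFT P r + P.real A := by
  rw [← integral_indicator_one hA]
  unfold sbbGFT expGFT
  refine le_of_le_of_eq ?_
    (integral_add (integrable_sbb P r) ((integrable_const (1 : ℝ)).indicator hA))
  refine integral_mono (integrable_sbb P q)
    ((integrable_sbb P r).add ((integrable_const (1 : ℝ)).indicator hA)) fun v => ?_
  have hr0 : 0 ≤ gft v (max r (secondHighest v.1)) r := gft_nonneg payment_le_highest
  have hA0 : 0 ≤ A.indicator (1 : Valuation n → ℝ) v :=
    Set.indicator_nonneg (fun _ _ => zero_le_one) _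
  show gft v (max q (secondHighest v.1)) q
    ≤ gft v (max r (secondHighest v.1)) r + A.indicator (1 : Valuation n → ℝ) v
  by_cases htrade : v.2 ≤ max q (secondHighest v.1) ∧ q ≤ highest v.1
  · by_cases hr : r ≤ highest v.1
    · have h' : v.2 ≤ max r (secondHighest v.1) := htrade.1.trans (max_le_max_right _ hqr)
      unfold gft at hr0 ⊢
      rw [if_pos htrade, if_pos ⟨h', hr⟩]
      linarith
    · have hmem : v ∈ A := hsub v htrade.2 (not_le.mp hr)
      rw [Set.indicator_of_mem hmem]
      have := gft_le_one v (max q (secondHighest v.1)) q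
      simp only [Pi.one_apply]
      linarith
  · have h0 : gft v (max q (secondHighest v.1)) q = 0 := if_neg htrade
    linarith

/-- The gain from trade with reserve price `q` is at most the probability that some bid
reaches `q`. -/
theorem sbbGFT_le_measure {q : unitInterval} {A : Set (Valuation n)}
    (hA : MeasurableSet A) (hsub : ∀ v : Valuation n, q ≤ highest v.1 → v ∈ A) :
    sbbGFT P q ≤ P.real A := by
  rw [← integral_indicator_one hA]
  refine integral_mono (integrable_sbb P q) ((integrable_const (1 : ℝ)).indicator hA) fun v => ?_
  show gft v (max q (secondHighest v.1)) q ≤ A.indicator (1 : Valuation n → ℝ) v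
  by_cases hq : q ≤ highest v.1
  · rw [Set.indicator_of_mem (hsub v hq)]
    exact gft_le_one _ _ _
  · rw [gft, if_neg fun h => hq h.2]
    exact Set.indicator_nonneg (fun _ _ => zero_le_one) _

end Expected

/-! ### Resampling one round of the market -/

section Resample

variable {n : ℕ}

/-- The valuations and the learner's draws, with those of round `t` replaced by `x`. -/
def resample (t : ℕ) (ω : (ℕ → Valuation n) × (ℕ → unitInterval))
    (x : Valuation n × unitInterval) : (ℕ → Valuation n) × (ℕ → unitInterval) :=
  (Function.update ω.1 t x.1, Function.update ω.2 t x.2)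

theorem measurePreserving_update_infinitePi {X : Type*} [MeasurableSpace X] (μ : Measure X)
    [IsProbabilityMeasure μ] (t : ℕ) :
    MeasurePreserving (fun z : (ℕ → X) × X => Function.update z.1 t z.2)
      ((Measure.infinitePi fun _ : ℕ => μ).prod μ) (Measure.infinitePi fun _ : ℕ => μ) := by
  have hmeas : Measurable fun z : (ℕ → X) × X => Function.update z.1 t z.2 := by
    refine measurable_pi_lambda _ fun s => ?_
    by_cases hs : s = t
    · subst hs
      simpa using measurable_snd
    · simp only [Function.update_of_ne hs]
      exact (measurable_pi_apply s).comp measurable_fst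
  refine ⟨hmeas, Measure.eq_infinitePi _ fun s B hB => ?_⟩
  rw [Measure.map_apply hmeas (.pi s.countable_toSet fun _ _ => hB _)]
  have hpre : (fun z : (ℕ → X) × X => Function.update z.1 t z.2) ⁻¹' (Set.pi s B)
      = (Set.pi ((s.erase t : Finset ℕ) : Set ℕ) B) ×ˢ (if t ∈ s then B t else Set.univ) := by
    ext z
    simp only [Set.mem_preimage, Set.mem_pi, Set.mem_prod, Finset.coe_erase, Set.mem_sdiff,
      Finset.mem_coe, Set.mem_singleton_iff]
    constructor
    · intro h
      refine ⟨fun i hi => by simpa [Function.update_of_ne hi.2] using h i hi.1, ?_⟩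
      split_ifs with ht
      · simpa using h t ht
      · trivial
    · rintro ⟨h1, h2⟩ i hi
      by_cases hit : i = t
      · subst hit
        rw [if_pos hi] at h2
        simpa using h2
      · simpa [Function.update_of_ne hit] using h1 i ⟨hi, hit⟩
  rw [hpre, Measure.prod_prod, Measure.infinitePi_pi _ fun i _ => hB i]
  split_ifs with ht
  · exact Finset.prod_erase_mul s (fun i => μ (B i)) ht
  · rw [Finset.erase_eq_of_notMem ht, measure_univ, mul_one]

instance (P : Measure (Valuation n)) [IsProbabilityMeasure P] :
    IsProbabilityMeasure (valuationLaw P) := by unfold valuationLaw; infer_instance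

instance : IsProbabilityMeasure learnerLaw := by unfold learnerLaw; infer_instance

theorem isResampling_resample (P : Measure (Valuation n)) [IsProbabilityMeasure P] :
    IsResampling ((valuationLaw P).prod learnerLaw) (P.prod (volume : Measure unitInterval))
      (resample (n := n)) := by
  intro t
  have hv : MeasurePreserving (fun z : (ℕ → Valuation n) × Valuation n =>
      Function.update z.1 t z.2) ((valuationLaw P).prod P) (valuationLaw P) :=
    measurePreserving_update_infinitePi P t
  have hu : MeasurePreserving (fun z : (ℕ → unitInterval) × unitInterval =>
      Function.update z.1 t z.2) (learnerLaw.prod volume) learnerLaw :=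
    measurePreserving_update_infinitePi volume t
  have h := hv.prod hu
  have hswap : MeasurePreserving
      (fun z : ((ℕ → Valuation n) × (ℕ → unitInterval)) × (Valuation n × unitInterval) =>
        ((z.1.1, z.2.1), (z.1.2, z.2.2)))
      (((valuationLaw P).prod learnerLaw).prod (P.prod volume))
      (((valuationLaw P).prod P).prod (learnerLaw.prod volume)) := by
    refine ⟨by fun_prop, ?_⟩
    refine (Measure.prod_eq_generateFrom generateFrom_prod generateFrom_prod isPiSystem_prod
      isPiSystem_prod
      ((valuationLaw P).toFiniteSpanningSetsIn.prod P.toFiniteSpanningSetsIn)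
      (learnerLaw.toFiniteSpanningSetsIn.prod
        (volume : Measure unitInterval).toFiniteSpanningSetsIn) ?_).symm
    rintro _ ⟨a, ha, b, hb, rfl⟩ _ ⟨c, hc, d, hd, rfl⟩
    rw [Set.mem_ofPred_eq] at ha hb hc hd
    rw [Measure.map_apply (by fun_prop) ((ha.prod hb).prod (hc.prod hd))]
    have hpre : (fun z : ((ℕ → Valuation n) × (ℕ → unitInterval)) × (Valuation n × unitInterval) =>
        ((z.1.1, z.2.1), (z.1.2, z.2.2))) ⁻¹' ((a ×ˢ b) ×ˢ (c ×ˢ d))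
        = (a ×ˢ c) ×ˢ (b ×ˢ d) := by
      ext z
      simp only [Set.mem_preimage, Set.mem_prod]
      tauto
    rw [hpre]
    simp only [Measure.prod_prod]
    ring
  exact h.comp hswap

end Resample

/-! ### The history in closed form -/

section History

variable {n : ℕ}

/-- The observation made in round `t`. -/
def obsAt (π : Policy n) (v : ℕ → Valuation n) (u : ℕ → unitInterval) (t : ℕ) : Observation n :=
  ⟨reserveAt π v u t, priceAt π v u t, visibleBids (reserveAt π v u t) (v t).1,
    decide ((v t).2 ≤ priceAt π v u t)⟩

theorem history_eq_map (π : Policy n) (v : ℕ → Valuation n) (u : ℕ → unitInterval) (t : ℕ) :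
    history π v u t = (List.range t).map (obsAt π v u) := by
  induction t with
  | zero => rfl
  | succ t ih =>
    rw [List.range_succ, List.map_append, ← ih]
    rfl

@[simp]
theorem length_history (π : Policy n) (v : ℕ → Valuation n) (u : ℕ → unitInterval) (t : ℕ) :
    (history π v u t).length = t := by
  simp [history_eq_map]

/-- The history before round `t` does not depend on the draws of round `t` and later. -/
theorem ignores_history (π : Policy n) {s t : ℕ} (hst : s ≤ t) :
    Ignores resample t fun ω => history π ω.1 ω.2 s := by
  intro ω x
  induction s with
  | zero => rfl
  | succ s ih =>
    have hne : s ≠ t := by omega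
    have h := ih (by omega)
    simp only [history, resample, Function.update_of_ne hne] at h ⊢
    rw [h]

theorem sum_map_range' {M : Type*} [AddCommMonoid M] (f : ℕ → M) (a b : ℕ) :
    ((List.range' a (b - a)).map f).sum = ∑ s ∈ Finset.Ico a b, f s := rfl

variable (T T₀ K : ℕ) (δ : ℝ) (pick : ℕ → Finset (Fin (K + 1)) → Fin (K + 1))
  (v : ℕ → Valuation n) (u : ℕ → unitInterval)

/-- The `k`-th grid price determined by the valuations of the first `T₀` rounds. -/
def gridArm (k : ℕ) : unitInterval :=
  gridPoint ((List.range T₀).map fun s => highest (v s).1) T₀ K k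

/-- The index of the grid price posted in round `t`, for `t` in the last phase. -/
def armIndex (t : ℕ) : Fin (K + 1) :=
  pick t (bestArms T T₀ K δ (history (algorithm n T T₀ K δ pick) v u t))

variable {T₀} {t : ℕ}

theorem reserveAt_of_lt (ht : t < T₀) :
    reserveAt (algorithm n T T₀ K δ pick) v u t = 0 := by
  simp [reserveAt, algorithm, algReserve, ht]

theorem reserveAt_of_lt_two_mul (h1 : T₀ ≤ t) (h2 : t < 2 * T₀) :
    reserveAt (algorithm n T T₀ K δ pick) v u t = u t := by
  simp [reserveAt, algorithm, algReserve, h1, h2]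

theorem arm_history (ht : T₀ ≤ t) (k : ℕ) :
    arm T₀ K (history (algorithm n T T₀ K δ pick) v u t) k = gridArm T₀ K v k := by
  unfold arm gridArm gridSamples
  rw [history_eq_map, ← List.map_take, List.take_range, min_eq_left ht, List.map_map]
  congr 1
  refine List.map_congr_left fun s hs => ?_
  have hs' := reserveAt_of_lt T K δ pick v u (List.mem_range.mp hs)
  simp only [Function.comp, obsAt, hs', highest_filledBids, threshold_zero]

theorem reserveAt_of_two_mul_le (ht : 2 * T₀ ≤ t) :
    reserveAt (algorithm n T T₀ K δ pick) v u t
      = gridArm T₀ K v (armIndex T T₀ K δ pick v u t) := by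
  have h1 : ¬ t < T₀ := by omega
  have h2 : ¬ t < 2 * T₀ := by omega
  have h := arm_history T K δ pick v u (show T₀ ≤ t by omega)
    (armIndex T T₀ K δ pick v u t)
  rw [← h]
  simp [reserveAt, algorithm, algReserve, h1, h2, armIndex]

theorem priceRuleAt_of_lt (ht : t < T₀) (b : Fin n → unitInterval) :
    priceRuleAt (algorithm n T T₀ K δ pick) v u t b = secondHighest b := by
  unfold priceRuleAt
  rw [reserveAt_of_lt T K δ pick v u ht]
  simp [algorithm, ht, secondHighest_filledBids, threshold_zero]

theorem priceRuleAt_of_lt_two_mul (h1 : T₀ ≤ t) (h2 : t < 2 * T₀) (b : Fin n → unitInterval) :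
    priceRuleAt (algorithm n T T₀ K δ pick) v u t b = u t := by
  simp [priceRuleAt, algorithm, h1, h2]

theorem priceRuleAt_of_two_mul_le (ht : 2 * T₀ ≤ t) (b : Fin n → unitInterval) :
    priceRuleAt (algorithm n T T₀ K δ pick) v u t b
      = max (reserveAt (algorithm n T T₀ K δ pick) v u t) (secondHighest b) := by
  have h1 : ¬ t < T₀ := by omega
  have h2 : ¬ t < 2 * T₀ := by omega
  rw [← max_threshold, ← secondHighest_filledBids]
  simp only [priceRuleAt, algorithm, length_history, h1, h2, if_false]
  rfl

/-- Every mechanism that the algorithm plays is weakly budget balanced. -/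
theorem rev_nonneg (t : ℕ) :
    0 ≤ rev (v t) (priceAt (algorithm n T T₀ K δ pick) v u t)
      (reserveAt (algorithm n T T₀ K δ pick) v u t) := by
  unfold rev priceAt
  split_ifs with h
  · refine sub_nonneg.mpr (Subtype.coe_le_coe.mpr ?_)
    rcases lt_or_ge t T₀ with h1 | h1
    · rw [priceRuleAt_of_lt T K δ pick v u h1]
      exact le_max_right _ _
    · rcases lt_or_ge t (2 * T₀) with h2 | h2
      · rw [priceRuleAt_of_lt_two_mul T K δ pick v u h1 h2,
          reserveAt_of_lt_two_mul T K δ pick v u h1 h2]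
        exact le_max_left _ _
      · rw [priceRuleAt_of_two_mul_le T K δ pick v u h2]
  · exact le_rfl

theorem gft1Hat_history (ht : 2 * T₀ ≤ t) (q : unitInterval) :
    gft1Hat T₀ (history (algorithm n T T₀ K δ pick) v u t) q
      = 1 / (T₀ : ℝ) * ∑ s ∈ Finset.Ico T₀ (2 * T₀), sellerShareSample (v s) (u s) q := by
  unfold gft1Hat
  congr 1
  have hlist : ((List.range t).drop T₀).take T₀ = List.range' T₀ (2 * T₀ - T₀) := by
    rw [List.range_eq_range', List.drop_range', List.take_range'_of_length_ge (by omega)]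
    congr 1 <;> omega
  rw [history_eq_map, ← List.map_drop, ← List.map_take, hlist, List.map_map,
    ← sum_map_range']
  congr 1
  refine List.map_congr_left fun s hs => ?_
  have hs' := List.mem_range'_1.mp hs
  have h1 : T₀ ≤ s := hs'.1
  have h2 : s < 2 * T₀ := by omega
  simp only [Function.comp, obsAt, priceAt, priceRuleAt_of_lt_two_mul T K δ pick v u h1 h2,
    reserveAt_of_lt_two_mul T K δ pick v u h1 h2, highest_filledBids, secondHighest_filledBids,
    decide_eq_true_eq, payment_condition_threshold _ _ _ _ (secondHighest_le_highest _)]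
  rfl

/-- The rounds before `t` of the last phase in which the reserve price `q` was posted. -/
def playRounds (T₀ : ℕ) (t : ℕ) (q : unitInterval) : Finset ℕ :=
  (Finset.Ico (2 * T₀) t).filter fun s => reserveAt (algorithm n T T₀ K δ pick) v u s = q

theorem playsOf_history (q : unitInterval) :
    playsOf T₀ (history (algorithm n T T₀ K δ pick) v u t) q
      = ((List.range' (2 * T₀) (t - 2 * T₀)).filter fun s =>
          decide (reserveAt (algorithm n T T₀ K δ pick) v u s = q)).map
        (obsAt (algorithm n T T₀ K δ pick) v u) := by
  unfold playsOf
  rw [history_eq_map, ← List.map_drop, List.range_eq_range', List.drop_range', List.filter_map]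
  simp only [Nat.zero_add, Nat.mul_one]
  rfl

theorem length_playsOf_history (q : unitInterval) :
    (playsOf T₀ (history (algorithm n T T₀ K δ pick) v u t) q).length
      = (playRounds T K δ pick v u T₀ t q).card := by
  rw [playsOf_history, List.length_map]
  rfl

theorem gft2Hat_history (q : unitInterval) :
    gft2Hat T₀ (history (algorithm n T T₀ K δ pick) v u t) q
      = 1 / ((playRounds T K δ pick v u T₀ t q).card : ℝ)
        * ∑ s ∈ playRounds T K δ pick v u T₀ t q, buyerShare (v s) q := by
  unfold gft2Hat
  rw [length_playsOf_history]
  congr 1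
  rw [playsOf_history, List.map_map]
  have hsum : ∑ s ∈ playRounds T K δ pick v u T₀ t q, buyerShare (v s) q
      = (((List.range' (2 * T₀) (t - 2 * T₀)).filter fun s =>
          decide (reserveAt (algorithm n T T₀ K δ pick) v u s = q)).map
            fun s => buyerShare (v s) q).sum := rfl
  rw [hsum]
  congr 1
  refine List.map_congr_left fun s hs => ?_
  obtain ⟨hs1, hs2⟩ := List.mem_filter.mp hs
  have hq := of_decide_eq_true hs2
  have h2 : 2 * T₀ ≤ s := (List.mem_range'_1.mp hs1).1
  simp only [Function.comp, obsAt, priceAt, priceRuleAt_of_two_mul_le T K δ pick v u h2, hq,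
    highest_filledBids, decide_eq_true_eq, le_threshold_iff]
  unfold buyerShare threshold
  by_cases h : q ≤ highest (v s).1
  · simp only [h, if_true]
  · simp only [h, false_and, if_false]

end History

/-! ### Measurability of the posted prices -/

section Measurability

variable {n : ℕ} (T T₀ K : ℕ) (δ : ℝ) (pick : ℕ → Finset (Fin (K + 1)) → Fin (K + 1))

theorem measurable_finset_sup {α ι : Type*} [MeasurableSpace α] (s : Finset ι)
    {f : ι → α → unitInterval} (hf : ∀ i ∈ s, Measurable (f i)) :
    Measurable fun x => s.sup fun i => f i x := by
  classical
  induction s using Finset.induction_on with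
  | empty => simp
  | insert a s _ ih =>
    simp only [Finset.sup_insert]
    exact (hf a (Finset.mem_insert_self _ _)).sup
      (ih fun i hi => hf i (Finset.mem_insert_of_mem hi))

theorem countP_map_range {α : Type*} (x : ℕ → α) (p : α → Prop) [DecidablePred p] (N : ℕ) :
    ((List.range N).map x).countP (fun a => decide (p a))
      = ∑ s ∈ Finset.range N, if p (x s) then 1 else 0 := by
  induction N with
  | zero => simp
  | succ N ih =>
    rw [List.range_succ, List.map_append, List.countP_append, ih, Finset.sum_range_succ]
    simp [List.countP_singleton]

theorem gridNext_eq_sup (x : ℕ → unitInterval) (N T₀ K : ℕ) (p : unitInterval) :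
    gridNext ((List.range N).map x) T₀ K p
      = if ∃ s ∈ Finset.range N, ((((List.range N).map x).countP fun b =>
            decide (p < b ∧ b < x s) : ℕ) : ℝ) ≤ (T₀ : ℝ) / K
        then (Finset.range N).sup fun s => if ((((List.range N).map x).countP fun b =>
            decide (p < b ∧ b < x s) : ℕ) : ℝ) ≤ (T₀ : ℝ) / K then x s else ⊥
        else 1 := by
  unfold gridNext
  simp only
  split_ifs with h1 h2 h2
  · apply le_antisymm
    · refine Finset.max'_le _ _ _ fun y hy => ?_
      obtain ⟨hy1, hy2⟩ := Finset.mem_filter.mp hy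
      obtain ⟨s, hs, rfl⟩ := List.mem_map.mp (List.mem_toFinset.mp hy1)
      refine le_trans ?_ (Finset.le_sup (Finset.mem_range.mpr (List.mem_range.mp hs)))
      rw [if_pos hy2]
    · refine Finset.sup_le fun s hs => ?_
      split_ifs with hc
      · refine Finset.le_max' _ _ (Finset.mem_filter.mpr ⟨List.mem_toFinset.mpr
          (List.mem_map.mpr ⟨s, List.mem_range.mpr (Finset.mem_range.mp hs), rfl⟩), hc⟩)
      · exact bot_le
  · obtain ⟨y, hy⟩ := h1
    obtain ⟨hy1, hy2⟩ := Finset.mem_filter.mp hy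
    obtain ⟨s, hs, rfl⟩ := List.mem_map.mp (List.mem_toFinset.mp hy1)
    exact absurd ⟨s, Finset.mem_range.mpr (List.mem_range.mp hs), hy2⟩ h2
  · obtain ⟨s, hs, hc⟩ := h2
    exact absurd ⟨x s, Finset.mem_filter.mpr ⟨List.mem_toFinset.mpr
      (List.mem_map.mpr ⟨s, List.mem_range.mpr (Finset.mem_range.mp hs), rfl⟩), hc⟩⟩ h1
  · rfl

theorem measurable_gridNext {α : Type*} [MeasurableSpace α] {x : ℕ → α → unitInterval}
    (hx : ∀ s, Measurable (x s)) {p : α → unitInterval} (hp : Measurable p) (N T₀ K : ℕ) :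
    Measurable fun a => gridNext ((List.range N).map fun s => x s a) T₀ K (p a) := by
  have hcount : ∀ s, Measurable fun a =>
      ((((List.range N).map fun s => x s a).countP fun b =>
        decide (p a < b ∧ b < x s a) : ℕ) : ℝ) := by
    intro s
    simp only [countP_map_range (fun s => x s _)]
    push_cast
    refine Finset.measurable_sum _ fun r _ => ?_
    have h1 : MeasurableSet {a | p a < x r a} := measurableSet_lt hp (hx r)
    have h2 : MeasurableSet {a | x r a < x s a} := measurableSet_lt (hx r) (hx s)
    exact Measurable.ite (h1.inter h2) measurable_const measurable_const
  have hset := fun s => measurableSet_le (hcount s) (measurable_const (a := (T₀ : ℝ) / K))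
  simp only [fun a => gridNext_eq_sup (fun s => x s a) N T₀ K (p a)]
  refine Measurable.ite ?_ ?_ measurable_const
  · have : {a | ∃ s ∈ Finset.range N, ((((List.range N).map fun s => x s a).countP fun b =>
        decide (p a < b ∧ b < x s a) : ℕ) : ℝ) ≤ (T₀ : ℝ) / K}
        = ⋃ s ∈ Finset.range N, {a | ((((List.range N).map fun s => x s a).countP fun b =>
        decide (p a < b ∧ b < x s a) : ℕ) : ℝ) ≤ (T₀ : ℝ) / K} := by
      ext a
      simp
    rw [this]
    exact Finset.measurableSet_biUnion _ fun s _ => hset s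
  · exact measurable_finset_sup _ fun s _ => Measurable.ite (hset s) (hx s) measurable_const

theorem measurable_gridArm (k : ℕ) :
    Measurable fun v : ℕ → Valuation n => gridArm T₀ K v k := by
  induction k with
  | zero => exact measurable_const
  | succ k ih =>
    exact measurable_gridNext (x := fun s (v : ℕ → Valuation n) => highest (v s).1)
      (fun s => measurable_highest_comp (measurable_pi_apply s)) ih T₀ T₀ K

theorem measurableSet_reserveAt_eq {t : ℕ}
    (hres : Measurable fun ω : (ℕ → Valuation n) × (ℕ → unitInterval) =>
      reserveAt (algorithm n T T₀ K δ pick) ω.1 ω.2 t)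
    {r : (ℕ → Valuation n) × (ℕ → unitInterval) → unitInterval} (hr : Measurable r) :
    MeasurableSet {ω : (ℕ → Valuation n) × (ℕ → unitInterval) |
      reserveAt (algorithm n T T₀ K δ pick) ω.1 ω.2 t = r ω} :=
  measurableSet_eq_fun hres hr

/-- The optimistic index of a price `r` is a measurable function of the past. -/
theorem measurable_ucbIndex {t : ℕ} (ht : 2 * T₀ ≤ t)
    (hres : ∀ s < t, Measurable fun ω : (ℕ → Valuation n) × (ℕ → unitInterval) =>
      reserveAt (algorithm n T T₀ K δ pick) ω.1 ω.2 s)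
    {r : (ℕ → Valuation n) × (ℕ → unitInterval) → unitInterval} (hr : Measurable r) :
    Measurable fun ω => ucbIndex T T₀ K δ
      (history (algorithm n T T₀ K δ pick) ω.1 ω.2 t) (r ω) := by
  have hplay : ∀ s ∈ Finset.Ico (2 * T₀) t, MeasurableSet
      {ω : (ℕ → Valuation n) × (ℕ → unitInterval) |
        reserveAt (algorithm n T T₀ K δ pick) ω.1 ω.2 s = r ω} := fun s hs =>
    measurableSet_reserveAt_eq T T₀ K δ pick (hres s (Finset.mem_Ico.mp hs).2) hr
  have hcard : Measurable fun ω : (ℕ → Valuation n) × (ℕ → unitInterval) =>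
      (playRounds T K δ pick ω.1 ω.2 T₀ t (r ω)).card := by
    simp only [playRounds, Finset.card_filter]
    exact Finset.measurable_sum _ fun s hs =>
      Measurable.ite (hplay s hs) measurable_const measurable_const
  have hcardR : Measurable fun ω : (ℕ → Valuation n) × (ℕ → unitInterval) =>
      ((playRounds T K δ pick ω.1 ω.2 T₀ t (r ω)).card : ℝ) :=
    measurable_from_top.comp hcard
  have hval : ∀ s, Measurable fun ω : (ℕ → Valuation n) × (ℕ → unitInterval) => ω.1 s :=
    fun s => (measurable_pi_apply s).comp measurable_fst
  have hdraw : ∀ s, Measurable fun ω : (ℕ → Valuation n) × (ℕ → unitInterval) => ω.2 s :=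
    fun s => (measurable_pi_apply s).comp measurable_snd
  have hsum : Measurable fun ω : (ℕ → Valuation n) × (ℕ → unitInterval) =>
      ∑ s ∈ playRounds T K δ pick ω.1 ω.2 T₀ t (r ω), buyerShare (ω.1 s) (r ω) := by
    simp only [playRounds, Finset.sum_filter]
    exact Finset.measurable_sum _ fun s hs =>
      Measurable.ite (hplay s hs) (measurable_buyerShare (hval s) hr) measurable_const
  unfold ucbIndex gft1Bar gft2Bar
  simp only [gft1Hat_history T K δ pick _ _ ht, gft2Hat_history, length_playsOf_history]
  refine Measurable.add ?_ (Measurable.ite ?_ measurable_const ?_)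
  · exact ((Finset.measurable_sum _ fun s _ =>
      measurable_sellerShareSample (hval s) (hdraw s) hr).const_mul _).add_const _
  · exact hcard (measurableSet_singleton 0)
  · exact ((measurable_const.div hcardR).mul hsum).add
      (measurable_const.div (hcardR.const_mul 2)).sqrt

/-- The reserve prices posted by the algorithm are measurable functions of the valuations and the
internal draws. -/
theorem measurable_reserveAt (t : ℕ) :
    Measurable fun ω : (ℕ → Valuation n) × (ℕ → unitInterval) =>
      reserveAt (algorithm n T T₀ K δ pick) ω.1 ω.2 t := by
  induction t using Nat.strong_induction_on with
  | _ t ih =>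
  rcases lt_or_ge t T₀ with h1 | h1
  · simp only [reserveAt_of_lt T K δ pick _ _ h1]
    exact measurable_const
  rcases lt_or_ge t (2 * T₀) with h2 | h2
  · simp only [reserveAt_of_lt_two_mul T K δ pick _ _ h1 h2]
    exact (measurable_pi_apply t).comp measurable_snd
  simp only [reserveAt_of_two_mul_le T K δ pick _ _ h2]
  have hgrid : ∀ k : ℕ, Measurable fun ω : (ℕ → Valuation n) × (ℕ → unitInterval) =>
      gridArm T₀ K ω.1 k := fun k => (measurable_gridArm T₀ K k).comp measurable_fst
  have hmem : ∀ k : Fin (K + 1), MeasurableSet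
      {ω : (ℕ → Valuation n) × (ℕ → unitInterval) |
        k ∈ bestArms T T₀ K δ (history (algorithm n T T₀ K δ pick) ω.1 ω.2 t)} := by
    intro k
    simp only [bestArms, Finset.mem_filter, Finset.mem_univ, true_and,
      arm_history T K δ pick _ _ h1]
    rw [Set.ofPred_forall]
    exact MeasurableSet.iInter fun j => measurableSet_le
      (measurable_ucbIndex T T₀ K δ pick h2 ih (hgrid j))
      (measurable_ucbIndex T T₀ K δ pick h2 ih (hgrid k))
  have hbest : ∀ A : Finset (Fin (K + 1)), MeasurableSet
      {ω : (ℕ → Valuation n) × (ℕ → unitInterval) |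
        bestArms T T₀ K δ (history (algorithm n T T₀ K δ pick) ω.1 ω.2 t) = A} := by
    intro A
    simp only [Finset.ext_iff]
    rw [Set.ofPred_forall]
    exact MeasurableSet.iInter fun k => (hmem k).iff (MeasurableSet.const (k ∈ A))
  have hidx : Measurable fun ω : (ℕ → Valuation n) × (ℕ → unitInterval) =>
      armIndex T T₀ K δ pick ω.1 ω.2 t := by
    refine measurable_to_countable' fun k => ?_
    have : (fun ω : (ℕ → Valuation n) × (ℕ → unitInterval) =>
        armIndex T T₀ K δ pick ω.1 ω.2 t) ⁻¹' {k}
        = ⋃ A ∈ {A : Finset (Fin (K + 1)) | pick t A = k},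
          {ω : (ℕ → Valuation n) × (ℕ → unitInterval) |
            bestArms T T₀ K δ (history (algorithm n T T₀ K δ pick) ω.1 ω.2 t) = A} := by
      ext ω
      simp [armIndex]
    rw [this]
    exact MeasurableSet.biUnion (Set.to_countable _) fun A _ => hbest A
  have hpair : Measurable fun z : Fin (K + 1) × ((ℕ → Valuation n) × (ℕ → unitInterval)) =>
      gridArm T₀ K z.2.1 z.1 := measurable_from_prod_countable_right fun k => hgrid k
  exact hpair.comp (hidx.prodMk measurable_id)

end Measurability

/-! ### The adaptive grid -/

section Grid

theorem gridNext_spec {B : List unitInterval} (hB : B ≠ []) (T₀ K : ℕ) (p : unitInterval) :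
    gridNext B T₀ K p ∈ B ∧ ((B.countP fun b => decide (p < b ∧ b < gridNext B T₀ K p) : ℕ) : ℝ)
        ≤ (T₀ : ℝ) / K ∧
      ∀ q ∈ B, ((B.countP fun b => decide (p < b ∧ b < q) : ℕ) : ℝ) ≤ (T₀ : ℝ) / K →
        q ≤ gridNext B T₀ K p := by
  have hne : (B.toFinset.filter fun q =>
      ((B.countP fun b => decide (p < b ∧ b < q) : ℕ) : ℝ) ≤ (T₀ : ℝ) / K).Nonempty := by
    -- no sample lies below the smallest one
    obtain ⟨q, hq, hmin⟩ := B.toFinset.exists_min_image id (List.toFinset_nonempty_iff B |>.mpr hB)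
    refine ⟨q, Finset.mem_filter.mpr ⟨hq, ?_⟩⟩
    have h0 : B.countP (fun b => decide (p < b ∧ b < q)) = 0 := by
      refine List.countP_eq_zero.mpr fun b hb => ?_
      have := hmin b (List.mem_toFinset.mpr hb)
      simp only [id] at this
      simp [this]
    rw [h0, Nat.cast_zero]
    positivity
  have heq : gridNext B T₀ K p = Finset.max' _ hne := by
    unfold gridNext
    exact dif_pos hne
  have hmem := Finset.max'_mem _ hne
  rw [← heq, Finset.mem_filter, List.mem_toFinset] at hmem
  refine ⟨hmem.1, hmem.2, fun q hq hc => ?_⟩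
  rw [heq]
  exact Finset.le_max' _ _ (Finset.mem_filter.mpr ⟨List.mem_toFinset.mpr hq, hc⟩)

theorem le_gridNext {B : List unitInterval} (hB : B ≠ []) (T₀ K : ℕ) {p : unitInterval}
    (hp : p = 0 ∨ p ∈ B) : p ≤ gridNext B T₀ K p := by
  rcases hp with rfl | hp
  · exact unitInterval.nonneg'
  · refine (gridNext_spec hB T₀ K p).2.2 p hp ?_
    have h0 : B.countP (fun b => decide (p < b ∧ b < p)) = 0 := by
      refine List.countP_eq_zero.mpr fun b _ => ?_
      simp only [decide_eq_true_eq, not_and, not_lt]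
      exact fun h => h.le
    rw [h0, Nat.cast_zero]
    positivity

theorem gridPoint_mem {B : List unitInterval} (hB : B ≠ []) (T₀ K k : ℕ) :
    gridPoint B T₀ K k = 0 ∨ gridPoint B T₀ K k ∈ B := by
  cases k with
  | zero => exact Or.inl rfl
  | succ k => exact Or.inr (gridNext_spec hB T₀ K _).1

theorem countP_add_countP_le {α : Type*} (B : List α) {p q r : α → Bool}
    (hpq : ∀ b ∈ B, p b = true → q b = false) (hpr : ∀ b ∈ B, p b = true → r b = true)
    (hqr : ∀ b ∈ B, q b = true → r b = true) : B.countP p + B.countP q ≤ B.countP r := by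
  induction B with
  | nil => simp
  | cons b B ih =>
    have h := ih (fun x hx => hpq x (List.mem_cons_of_mem _ hx))
      (fun x hx => hpr x (List.mem_cons_of_mem _ hx))
      (fun x hx => hqr x (List.mem_cons_of_mem _ hx))
    have h1 := hpq b List.mem_cons_self
    have h2 := hpr b List.mem_cons_self
    have h3 := hqr b List.mem_cons_self
    simp only [List.countP_cons]
    cases hp : p b <;> cases hq : q b <;> cases hr : r b <;> simp_all <;> omega

/-- Unless it covers all samples, a grid step passes more than `T₀ / K` of them. -/
theorem gridNext_covers_or {B : List unitInterval} (hB : B ≠ []) (T₀ K : ℕ) {p : unitInterval}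
    (hp : p = 0 ∨ p ∈ B) :
    (∀ b ∈ B, b ≤ gridNext B T₀ K p) ∨
      ((B.countP fun b => decide (b ≤ p) : ℕ) : ℝ) + (T₀ : ℝ) / K
        < ((B.countP fun b => decide (b ≤ gridNext B T₀ K p) : ℕ) : ℝ) := by
  by_contra! hcon
  obtain ⟨⟨b₀, hb₀, hlt₀⟩, hle⟩ := hcon
  have hpn := le_gridNext hB T₀ K hp
  set p' := gridNext B T₀ K p with hp'
  -- the first sample above the new grid point is not admissible
  obtain ⟨q, hq, hmin⟩ := (B.toFinset.filter fun b => p' < b).exists_min_image id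
    ⟨b₀, Finset.mem_filter.mpr ⟨List.mem_toFinset.mpr hb₀, hlt₀⟩⟩
  obtain ⟨hqB, hqlt⟩ := Finset.mem_filter.mp hq
  have hbig : (T₀ : ℝ) / K < ((B.countP fun b => decide (p < b ∧ b < q) : ℕ) : ℝ) := by
    by_contra! hc
    exact absurd hqlt (not_lt.mpr ((gridNext_spec hB T₀ K p).2.2 q (List.mem_toFinset.mp hqB) hc))
  have hadd : B.countP (fun b => decide (b ≤ p)) + B.countP (fun b => decide (p < b ∧ b < q))
      ≤ B.countP fun b => decide (b ≤ p') := by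
    refine countP_add_countP_le B (fun b _ h => ?_) (fun b _ h => ?_) (fun b hb h => ?_)
    · simp only [decide_eq_true_eq] at h
      simp only [decide_eq_false_iff_not, not_and, not_lt]
      exact fun h' => absurd h (not_le.mpr h')
    · simp only [decide_eq_true_eq] at h ⊢
      exact h.trans hpn
    · simp only [decide_eq_true_eq] at h ⊢
      by_contra! hb'
      have := hmin b (Finset.mem_filter.mpr ⟨List.mem_toFinset.mpr hb, hb'⟩)
      exact absurd h.2 (not_lt.mpr this)
  have hadd' : ((B.countP fun b => decide (b ≤ p) : ℕ) : ℝ)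
      + ((B.countP fun b => decide (p < b ∧ b < q) : ℕ) : ℝ)
      ≤ ((B.countP fun b => decide (b ≤ p') : ℕ) : ℝ) := by exact_mod_cast hadd
  linarith

/-- The last grid point is an upper bound of the samples. -/
theorem le_gridPoint_last {B : List unitInterval} {T₀ K : ℕ} (hB : B ≠ []) (hlen : B.length = T₀)
    (hK : 1 ≤ K) : ∀ b ∈ B, b ≤ gridPoint B T₀ K K := by
  have key : ∀ k, (∀ b ∈ B, b ≤ gridPoint B T₀ K (k + 1)) ∨
      ((k + 1 : ℕ) : ℝ) * ((T₀ : ℝ) / K)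
        < ((B.countP fun b => decide (b ≤ gridPoint B T₀ K (k + 1)) : ℕ) : ℝ) := by
    intro k
    induction k with
    | zero =>
      rcases gridNext_covers_or hB T₀ K (gridPoint_mem hB T₀ K 0) with h | h
      · exact Or.inl h
      · refine Or.inr (lt_of_le_of_lt ?_ h)
        have : (0 : ℝ) ≤ ((B.countP fun b => decide (b ≤ gridPoint B T₀ K 0) : ℕ) : ℝ) := by
          positivity
        push_cast
        linarith
    | succ k ih =>
      rcases gridNext_covers_or hB T₀ K (gridPoint_mem hB T₀ K (k + 1)) with h | h
      · exact Or.inl h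
      · rcases ih with ih | ih
        · exact Or.inl fun b hb =>
            (ih b hb).trans (le_gridNext hB T₀ K (gridPoint_mem hB T₀ K (k + 1)))
        · refine Or.inr (lt_of_le_of_lt ?_ h)
          push_cast at ih ⊢
          linarith
  obtain ⟨k, rfl⟩ : ∃ k, K = k + 1 := ⟨K - 1, by omega⟩
  rcases key k with h | h
  · exact h
  · exfalso
    have hle : ((B.countP fun b => decide (b ≤ gridPoint B T₀ (k + 1) (k + 1)) : ℕ) : ℝ)
        ≤ (T₀ : ℝ) := by
      rw [← hlen]
      exact_mod_cast List.countP_le_length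
    have hne : ((k + 1 : ℕ) : ℝ) ≠ 0 := by positivity
    rw [mul_div_cancel₀ _ hne] at h
    linarith

end Grid

/-! ### The grid is fine enough -/

section Cover

variable {n : ℕ} (P : Measure (Valuation n)) (T₀ K : ℕ)

/-- The valuations whose highest bid lies strictly between the `i`-th and the `j`-th sample. An
index that is not below `T₀` stands for the lower end point `0` or for no upper bound at all. -/
def gapSet (i j : ℕ) (v : ℕ → Valuation n) : Set (Valuation n) :=
  {y | (if i < T₀ then highest (v i).1 else 0) < highest y.1 ∧
    (j < T₀ → highest y.1 < highest (v j).1)}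

theorem measurableSet_gapSet (i j : ℕ) {α : Type*} [MeasurableSpace α]
    {v : α → ℕ → Valuation n} {y : α → Valuation n} (hv : Measurable v) (hy : Measurable y) :
    MeasurableSet {a | y a ∈ gapSet T₀ i j (v a)} := by
  have hs : ∀ s, Measurable fun a => highest (v a s).1 := fun s =>
    measurable_highest_comp ((measurable_pi_apply s).comp hv)
  have h1 : MeasurableSet {a | (if i < T₀ then highest (v a i).1 else 0) < highest (y a).1} := by
    refine measurableSet_lt ?_ (measurable_highest_comp hy)
    split_ifs
    · exact hs i
    · exact measurable_const
  have h2 : MeasurableSet {a | j < T₀ → highest (y a).1 < highest (v a j).1} := by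
    by_cases hj : j < T₀
    · simpa only [hj, true_imp_iff] using measurableSet_lt (measurable_highest_comp hy) (hs j)
    · simp [hj]
  exact h1.inter h2

/-- Up to a deviation governed by `l`, the first `T₀` samples do not underestimate the probability
of any gap between two of them. -/
def GapsAccurate (l : ℝ) (v : ℕ → Valuation n) : Prop :=
  ∀ i ∈ Finset.range (T₀ + 1), ∀ j ∈ Finset.range (T₀ + 1),
    (T₀ : ℝ) * P.real (gapSet T₀ i j v)
      ≤ 2 + ∑ s ∈ Finset.range T₀, (gapSet T₀ i j v).indicator 1 (v s) + Real.sqrt (T₀ * l / 2)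

variable [IsProbabilityMeasure P]

/-- The end points of a gap are themselves samples. They are left out of the count, so that the
other samples are independent of the gap. -/
theorem measure_gap_inaccurate_le {l : ℝ} (hl : 0 ≤ l) (i j : ℕ) :
    ((valuationLaw P).prod learnerLaw) {ω |
      2 + ∑ s ∈ Finset.range T₀, (gapSet T₀ i j ω.1).indicator (1 : Valuation n → ℝ) (ω.1 s)
        + Real.sqrt (T₀ * l / 2) < (T₀ : ℝ) * P.real (gapSet T₀ i j ω.1)}
      ≤ ENNReal.ofReal (Real.exp (-l)) := by
  set S := ((Finset.range T₀).erase i).erase j with hS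
  have hsub : S ⊆ Finset.range T₀ :=
    (Finset.erase_subset _ _).trans (Finset.erase_subset _ _)
  have hcard : (T₀ : ℝ) ≤ S.card + 2 := by
    have h1 := Finset.pred_card_le_card_erase (s := Finset.range T₀) (a := i)
    have h2 := Finset.pred_card_le_card_erase (s := (Finset.range T₀).erase i) (a := j)
    rw [Finset.card_range] at h1
    rw [← hS] at h2
    have : T₀ ≤ S.card + 2 := by omega
    exact_mod_cast this
  have hcard' : (S.card : ℝ) ≤ T₀ := by
    have := Finset.card_le_card hsub
    rw [Finset.card_range] at this
    exact_mod_cast this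
  have hprob : ∀ A : Set (Valuation n), P.real A ≤ 1 := fun A => measureReal_le_one
  rcases Nat.eq_zero_or_pos S.card with h0 | hpos
  · refine (measure_mono_null (t := ∅) ?_ measure_empty).trans_le zero_le
    intro ω hω
    simp only [Set.mem_ofPred_eq] at hω
    have h1 : 0 ≤ ∑ s ∈ Finset.range T₀,
        (gapSet T₀ i j ω.1).indicator (1 : Valuation n → ℝ) (ω.1 s) :=
      Finset.sum_nonneg fun s _ => Set.indicator_nonneg (fun _ _ => zero_le_one) _
    have h2 := Real.sqrt_nonneg (T₀ * l / 2)
    rw [h0] at hcard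
    have h3 : (T₀ : ℝ) * P.real (gapSet T₀ i j ω.1) ≤ (T₀ : ℝ) * 1 :=
      mul_le_mul_of_nonneg_left (hprob _) (by positivity)
    push_cast at hcard
    linarith
  have hgap : ∀ t ∈ S, ∀ (ω : (ℕ → Valuation n) × (ℕ → unitInterval)) x,
      gapSet T₀ i j (resample t ω x).1 = gapSet T₀ i j ω.1 := by
    intro t ht ω x
    have htj : j ≠ t := (Finset.ne_of_mem_erase ht).symm
    have hti : i ≠ t := (Finset.ne_of_mem_erase (Finset.mem_of_mem_erase ht)).symm
    simp only [gapSet, resample, Function.update_of_ne htj, Function.update_of_ne hti]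
  have hval : ∀ s, Measurable fun ω : (ℕ → Valuation n) × (ℕ → unitInterval) => ω.1 s :=
    fun s => (measurable_pi_apply s).comp measurable_fst
  have hgapm : ∀ v : ℕ → Valuation n, MeasurableSet (gapSet T₀ i j v) := fun v =>
    measurableSet_gapSet T₀ i j measurable_const measurable_id
  classical
  have hdev := measure_count_eq_le (isResampling_resample P) S (fun _ _ => True)
    (fun s ω => (gapSet T₀ i j ω.1).indicator (1 : Valuation n → ℝ) (ω.1 s))
    (fun ω => P.real (gapSet T₀ i j ω.1))
    (fun t _ => MeasurableSet.const True)
    (fun t _ => by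
      simp only [Set.indicator_apply]
      exact Measurable.ite (measurableSet_gapSet T₀ i j measurable_fst (hval t))
        measurable_const measurable_const)
    ((measurable_measure_prodMk_left (ν := P) (measurableSet_gapSet T₀ i j
      (measurable_fst.comp measurable_fst) measurable_snd)).ennreal_toReal)
    (fun _ _ _ _ _ _ _ => rfl)
    (fun s hs t ht hst ω x => by
      simp only [hgap t ht ω x]
      simp only [resample, Function.update_of_ne hst.ne])
    (fun t ht ω x => by simp only [hgap t ht ω x])
    (fun t _ ω => ⟨Set.indicator_nonneg (fun _ _ => zero_le_one) _,
      Set.indicator_le_self' (fun _ _ => zero_le_one) _⟩)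
    (fun t ht ω => by
      simp only [hgap t ht ω]
      simp only [resample, Function.update_self]
      rw [integral_fun_fst (fun y => (gapSet T₀ i j ω.1).indicator (1 : Valuation n → ℝ) y),
        integral_indicator_one (hgapm ω.1)]
      simp)
    (σ := -1) (by norm_num) hpos hl
  refine (measure_mono ?_).trans hdev
  intro ω hω
  simp only [Set.mem_ofPred_eq, Finset.filter_true, Finset.sum_sub_distrib, Finset.sum_const,
    nsmul_eq_mul, true_and] at hω ⊢
  have h1 : ∑ s ∈ S, (gapSet T₀ i j ω.1).indicator (1 : Valuation n → ℝ) (ω.1 s)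
      ≤ ∑ s ∈ Finset.range T₀, (gapSet T₀ i j ω.1).indicator (1 : Valuation n → ℝ) (ω.1 s) :=
    Finset.sum_le_sum_of_subset_of_nonneg hsub fun s _ _ =>
      Set.indicator_nonneg (fun _ _ => zero_le_one) _
  have h2 : Real.sqrt (S.card * l / 2) ≤ Real.sqrt (T₀ * l / 2) :=
    Real.sqrt_le_sqrt (by gcongr)
  have h3 : (T₀ : ℝ) * P.real (gapSet T₀ i j ω.1)
      ≤ (S.card + 2) * P.real (gapSet T₀ i j ω.1) := by gcongr
  have h4 := hprob (gapSet T₀ i j ω.1)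
  linarith

theorem measure_not_gapsAccurate_le {l : ℝ} (hl : 0 ≤ l) :
    ((valuationLaw P).prod learnerLaw) {ω | ¬ GapsAccurate P T₀ l ω.1}
      ≤ ((T₀ + 1) * (T₀ + 1) : ℕ) * ENNReal.ofReal (Real.exp (-l)) := by
  have hsub : {ω : (ℕ → Valuation n) × (ℕ → unitInterval) | ¬ GapsAccurate P T₀ l ω.1}
      ⊆ ⋃ z ∈ Finset.range (T₀ + 1) ×ˢ Finset.range (T₀ + 1), {ω |
        2 + ∑ s ∈ Finset.range T₀, (gapSet T₀ z.1 z.2 ω.1).indicator (1 : Valuation n → ℝ) (ω.1 s)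
        + Real.sqrt (T₀ * l / 2) < (T₀ : ℝ) * P.real (gapSet T₀ z.1 z.2 ω.1)} := by
    intro ω hω
    simp only [Set.mem_ofPred_eq, GapsAccurate, not_forall, not_le] at hω
    obtain ⟨i, hi, j, hj, h⟩ := hω
    simp only [Set.mem_iUnion]
    exact ⟨(i, j), Finset.mem_product.mpr ⟨hi, hj⟩, h⟩
  refine (measure_mono hsub).trans ((measure_biUnion_finset_le _ _).trans ?_)
  refine (Finset.sum_le_sum fun z _ => measure_gap_inaccurate_le P T₀ hl z.1 z.2).trans ?_
  simp

open Classical in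
/-- The first grid index whose price is at least `q`, or the last one if there is none. -/
def coverIndex (q : unitInterval) (v : ℕ → Valuation n) : ℕ :=
  Nat.find (⟨K, Or.inr rfl⟩ : ∃ k, q ≤ gridArm T₀ K v k ∨ k = K)

/-- The grid price with index `coverIndex`. -/
def coverArm (q : unitInterval) (v : ℕ → Valuation n) : unitInterval :=
  gridArm T₀ K v (coverIndex T₀ K q v)

theorem coverIndex_le (q : unitInterval) (v : ℕ → Valuation n) : coverIndex T₀ K q v ≤ K := by
  classical
  exact Nat.find_min' _ (Or.inr rfl)

theorem measurable_coverArm (q : unitInterval) :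
    Measurable (coverArm (n := n) T₀ K q) := by
  classical
  have hidx : Measurable (coverIndex (n := n) T₀ K q) := by
    unfold coverIndex
    refine measurable_find _ fun k => ?_
    have h1 : MeasurableSet {v : ℕ → Valuation n | q ≤ gridArm T₀ K v k} :=
      measurableSet_le measurable_const (measurable_gridArm T₀ K k)
    exact h1.union (MeasurableSet.const (k = K))
  have hpair : Measurable fun z : ℕ × (ℕ → Valuation n) => gridArm T₀ K z.2 z.1 :=
    measurable_from_prod_countable_right fun k => measurable_gridArm T₀ K k
  exact hpair.comp (hidx.prodMk measurable_id)

/-- On the event of accurate gaps, the grid price that covers `q` is nearly as good as `q`. -/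
theorem sbbGFT_le_coverArm {l : ℝ} (hT₀ : 1 ≤ T₀) (hK : 1 ≤ K) {v : ℕ → Valuation n}
    (hv : GapsAccurate P T₀ l v) (q : unitInterval) :
    sbbGFT P q ≤ sbbGFT P (coverArm T₀ K q v)
      + (2 + (T₀ : ℝ) / K + Real.sqrt (T₀ * l / 2)) / T₀ := by
  classical
  set B := (List.range T₀).map fun s => highest (v s).1 with hBdef
  have hlen : B.length = T₀ := by simp [hBdef]
  have hB : B ≠ [] := by
    intro h
    rw [h] at hlen
    simp at hlen
    omega
  have hT₀' : (0 : ℝ) < T₀ := by exact_mod_cast hT₀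
  have hgrid : ∀ k, gridArm T₀ K v k = gridPoint B T₀ K k := fun k => rfl
  have hmemB : ∀ b, b ∈ B ↔ ∃ s < T₀, highest (v s).1 = b := by
    intro b
    simp [hBdef]
  -- a grid price is the left end point of a gap
  have hleft : ∀ k, ∃ i ∈ Finset.range (T₀ + 1),
      (if i < T₀ then highest (v i).1 else 0) = gridArm T₀ K v k := by
    intro k
    rcases gridPoint_mem hB T₀ K k with h | h
    · exact ⟨T₀, by simp, by simp [hgrid, h]⟩
    · obtain ⟨s, hs, hs'⟩ := (hmemB _).mp h
      exact ⟨s, Finset.mem_range.mpr (by omega), by rw [if_pos hs, hs', hgrid]⟩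
  have hmeas : ∀ i j, MeasurableSet (gapSet T₀ i j v) := fun i j =>
    measurableSet_gapSet T₀ i j measurable_const measurable_id
  have hrest : 0 ≤ (2 + (T₀ : ℝ) / K + Real.sqrt (T₀ * l / 2)) / T₀ := by positivity
  have hgapbound : ∀ i ∈ Finset.range (T₀ + 1), ∀ j ∈ Finset.range (T₀ + 1),
      ∑ s ∈ Finset.range T₀, (gapSet T₀ i j v).indicator (1 : Valuation n → ℝ) (v s)
        ≤ (T₀ : ℝ) / K →
      P.real (gapSet T₀ i j v) ≤ (2 + (T₀ : ℝ) / K + Real.sqrt (T₀ * l / 2)) / T₀ := by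
    intro i hi j hj hc
    rw [le_div_iff₀ hT₀', mul_comm]
    have := hv i hi j hj
    linarith
  have hspec : q ≤ gridArm T₀ K v (coverIndex T₀ K q v) ∨ coverIndex T₀ K q v = K :=
    Nat.find_spec (⟨K, Or.inr rfl⟩ : ∃ k, q ≤ gridArm T₀ K v k ∨ k = K)
  have hmin : ∀ k < coverIndex T₀ K q v, ¬ (q ≤ gridArm T₀ K v k ∨ k = K) := fun k hk =>
    Nat.find_min (⟨K, Or.inr rfl⟩ : ∃ k, q ≤ gridArm T₀ K v k ∨ k = K) hk
  unfold coverArm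
  by_cases hq : q ≤ gridArm T₀ K v (coverIndex T₀ K q v)
  · cases hk : coverIndex T₀ K q v with
    | zero =>
      have h0 : q = gridArm T₀ K v 0 := by
        rw [hk] at hq
        exact le_antisymm hq unitInterval.nonneg'
      rw [← h0]
      linarith
    | succ k =>
      have hqk : gridArm T₀ K v k < q := by
        have := hmin k (by omega)
        push Not at this
        exact this.1
      rw [hk] at hq
      obtain ⟨i, hi, hi'⟩ := hleft k
      have hsp := gridNext_spec hB T₀ K (gridPoint B T₀ K k)
      obtain ⟨j, hj, hj'⟩ := (hmemB _).mp hsp.1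
      have hcount : ∑ s ∈ Finset.range T₀,
          (gapSet T₀ i j v).indicator (1 : Valuation n → ℝ) (v s) ≤ (T₀ : ℝ) / K := by
        refine le_trans (le_of_eq ?_) hsp.2.1
        rw [hBdef, countP_map_range (fun s => highest (v s).1), ← hBdef]
        push_cast
        refine Finset.sum_congr rfl fun s _ => ?_
        rw [Set.indicator_apply]
        simp only [gapSet, Set.mem_ofPred_eq, hi', hj, true_imp_iff, hj', hgrid, Pi.one_apply]
      refine (sbbGFT_le_add_measure P hq (hmeas i j) fun y hy1 hy2 => ?_).trans
        (add_le_add_right (hgapbound i hi j (Finset.mem_range.mpr (by omega)) hcount) _)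
      refine ⟨?_, fun _ => ?_⟩
      · rw [hi']
        exact hqk.trans_le hy1
      · rw [hj']
        exact hy2
  · have hk : coverIndex T₀ K q v = K := hspec.resolve_left hq
    rw [hk] at hq ⊢
    obtain ⟨i, hi, hi'⟩ := hleft K
    have hcount : ∑ s ∈ Finset.range T₀,
        (gapSet T₀ i T₀ v).indicator (1 : Valuation n → ℝ) (v s) ≤ (T₀ : ℝ) / K := by
      rw [Finset.sum_eq_zero]
      · positivity
      · intro s hs
        refine Set.indicator_of_notMem (fun hmem => ?_) _
        have h1 := hmem.1
        rw [hi'] at h1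
        exact absurd h1 (not_lt.mpr (le_gridPoint_last hB hlen hK _
          ((hmemB _).mpr ⟨s, Finset.mem_range.mp hs, rfl⟩)))
    have h1 := sbbGFT_le_measure P (q := q) (hmeas i T₀) fun y hy => by
      refine ⟨?_, fun h => absurd h (lt_irrefl _)⟩
      rw [hi']
      exact (not_le.mp hq).trans_le hy
    have h2 := hgapbound i hi T₀ (by simp) hcount
    have h3 := sbbGFT_nonneg P (gridArm T₀ K v K)
    linarith

end Cover

/-! ### Accuracy of the estimates -/

section Estimates

variable {n : ℕ} (P : Measure (Valuation n)) [IsProbabilityMeasure P]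
  (T T₀ K : ℕ) (δ : ℝ) (pick : ℕ → Finset (Fin (K + 1)) → Fin (K + 1))

theorem ignores_gridArm {t : ℕ} (ht : T₀ ≤ t) (k : ℕ) :
    Ignores (resample (n := n)) t fun ω => gridArm T₀ K ω.1 k := by
  intro ω x
  refine congrArg (fun B => gridPoint B T₀ K k) (List.map_congr_left fun s hs => ?_)
  have hne : s ≠ t := by
    have := List.mem_range.mp hs
    omega
  simp only [resample, Function.update_of_ne hne]

theorem ignores_coverArm {t : ℕ} (ht : T₀ ≤ t) (q : unitInterval) :
    Ignores (resample (n := n)) t fun ω => coverArm T₀ K q ω.1 := by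
  intro ω x
  have h := fun k => ignores_gridArm (n := n) T₀ K ht k ω x
  simp only [coverArm, coverIndex] at h ⊢
  simp only [h]

theorem ignores_reserveAt {s t : ℕ} (hs : 2 * T₀ ≤ s) (hst : s ≤ t) :
    Ignores resample t fun ω : (ℕ → Valuation n) × (ℕ → unitInterval) =>
      reserveAt (algorithm n T T₀ K δ pick) ω.1 ω.2 s := by
  intro ω x
  have h1 := ignores_history (algorithm n T T₀ K δ pick) hst ω x
  have h2 := ignores_gridArm (n := n) T₀ K (show T₀ ≤ t by omega)
    (armIndex T T₀ K δ pick ω.1 ω.2 s) ω x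
  simp only [reserveAt_of_two_mul_le T K δ pick _ _ hs, armIndex] at h1 h2 ⊢
  rw [h1, h2]

variable {r : (ℕ → Valuation n) × (ℕ → unitInterval) → unitInterval} (hr : Measurable r)
  (hrpast : ∀ t, T₀ ≤ t → Ignores resample t r) {σ l : ℝ} (hσ : σ ^ 2 = 1) (hl : 0 ≤ l)

include hr hrpast hσ hl

/-- Accuracy of the estimate of the seller's share from the uniform prices, at a price that is
determined by the samples of the first phase. -/
theorem measure_sellerShare_deviation_le (hT₀ : 1 ≤ T₀) :
    ((valuationLaw P).prod learnerLaw) {ω | Real.sqrt (T₀ * l / 2)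
        ≤ σ * ∑ s ∈ Finset.Ico T₀ (2 * T₀),
          (sellerShareSample (ω.1 s) (ω.2 s) (r ω) - expSellerShare P (r ω))}
      ≤ ENNReal.ofReal (Real.exp (-l)) := by
  have hmem : ∀ t ∈ Finset.Ico T₀ (2 * T₀), T₀ ≤ t := fun t ht => (Finset.mem_Ico.mp ht).1
  have h := measure_count_eq_le (isResampling_resample P) (Finset.Ico T₀ (2 * T₀))
    (fun _ _ => True) (fun s ω => sellerShareSample (ω.1 s) (ω.2 s) (r ω))
    (fun ω => expSellerShare P (r ω))
    (fun t _ => MeasurableSet.const True)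
    (fun t _ => measurable_sellerShareSample ((measurable_pi_apply t).comp measurable_fst)
      ((measurable_pi_apply t).comp measurable_snd) hr)
    ((measurable_expSellerShare P).comp hr)
    (fun _ _ _ _ _ _ _ => rfl)
    (fun s hs t ht hst ω x => by
      simp only [hrpast t (hmem t ht) ω x]
      simp only [resample, Function.update_of_ne hst.ne])
    (fun t ht ω x => by simp only [hrpast t (hmem t ht) ω x])
    (fun t _ ω => sellerShareSample_mem_Icc _ _ _)
    (fun t ht ω => by
      simp only [hrpast t (hmem t ht) ω]
      simp only [resample, Function.update_self]
      exact integral_sellerShareSample_prod P (r ω))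
    hσ hT₀ hl
  refine (measure_mono ?_).trans h
  intro ω hω
  simp only [Finset.filter_true, Nat.card_Ico]
  exact ⟨by omega, hω⟩

/-- Accuracy of the empirical buyer's share, in all rounds of the last phase, at a price that is
determined by the samples of the first phase. -/
theorem measure_buyerShare_deviation_le :
    ((valuationLaw P).prod learnerLaw) {ω | ∃ t ≤ T,
        1 ≤ (playRounds T K δ pick ω.1 ω.2 T₀ t (r ω)).card ∧
        Real.sqrt ((playRounds T K δ pick ω.1 ω.2 T₀ t (r ω)).card * l / 2)
          ≤ σ * ∑ s ∈ playRounds T K δ pick ω.1 ω.2 T₀ t (r ω),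
            (buyerShare (ω.1 s) (r ω) - expBuyerShare P (r ω))}
      ≤ T * ENNReal.ofReal (Real.exp (-l)) := by
  have hmem : ∀ t ∈ Finset.Ico (2 * T₀) T, T₀ ≤ t := fun t ht => by
    have := (Finset.mem_Ico.mp ht).1
    omega
  have h := measure_exists_deviation_le (isResampling_resample P) (2 * T₀) T
    (fun s ω => reserveAt (algorithm n T T₀ K δ pick) ω.1 ω.2 s = r ω)
    (fun s ω => buyerShare (ω.1 s) (r ω))
    (fun ω => expBuyerShare P (r ω))
    (fun t _ => measurableSet_reserveAt_eq T T₀ K δ pick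
      (measurable_reserveAt T T₀ K δ pick t) hr)
    (fun t _ => measurable_buyerShare ((measurable_pi_apply t).comp measurable_fst) hr)
    ((measurable_expBuyerShare P).comp hr)
    (fun s hs t ht hst ω x => by
      have h1 := ignores_reserveAt (n := n) T T₀ K δ pick (Finset.mem_Ico.mp hs).1 hst ω x
      simp only at h1
      simp only [hrpast t (hmem t ht) ω x, h1])
    (fun s hs t ht hst ω x => by
      simp only [hrpast t (hmem t ht) ω x]
      simp only [resample, Function.update_of_ne hst.ne])
    (fun t ht ω x => by simp only [hrpast t (hmem t ht) ω x])
    (fun t _ ω => buyerShare_mem_Icc _ _)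
    (fun t ht ω => by
      simp only [hrpast t (hmem t ht) ω]
      simp only [resample, Function.update_self]
      exact integral_buyerShare_prod P (r ω))
    hσ hl
  refine h.trans ?_
  gcongr
  exact Nat.sub_le _ _

end Estimates

/-! ### The good event -/

section Good

variable {n : ℕ} (P : Measure (Valuation n)) (T T₀ K : ℕ) (δ : ℝ)
  (pick : ℕ → Finset (Fin (K + 1)) → Fin (K + 1)) (q : unitInterval) (l₀ l : ℝ)

/-- The event on which the regret is small. Underestimation is excluded only for the grid price
that covers `q`, with the level `l₀` of the algorithm; overestimation is excluded for all grid
prices, with the larger level `l`. -/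
structure IsGood (ω : (ℕ → Valuation n) × (ℕ → unitInterval)) : Prop where
  gaps : GapsAccurate P T₀ l ω.1
  seller_lower : -1 * ∑ s ∈ Finset.Ico T₀ (2 * T₀),
    (sellerShareSample (ω.1 s) (ω.2 s) (coverArm T₀ K q ω.1)
      - expSellerShare P (coverArm T₀ K q ω.1)) < Real.sqrt (T₀ * l₀ / 2)
  buyer_lower : ∀ t ≤ T, 1 ≤ (playRounds T K δ pick ω.1 ω.2 T₀ t (coverArm T₀ K q ω.1)).card →
    -1 * ∑ s ∈ playRounds T K δ pick ω.1 ω.2 T₀ t (coverArm T₀ K q ω.1),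
      (buyerShare (ω.1 s) (coverArm T₀ K q ω.1) - expBuyerShare P (coverArm T₀ K q ω.1))
      < Real.sqrt ((playRounds T K δ pick ω.1 ω.2 T₀ t (coverArm T₀ K q ω.1)).card * l₀ / 2)
  seller_upper : ∀ k ∈ Finset.range (K + 1), 1 * ∑ s ∈ Finset.Ico T₀ (2 * T₀),
    (sellerShareSample (ω.1 s) (ω.2 s) (gridArm T₀ K ω.1 k)
      - expSellerShare P (gridArm T₀ K ω.1 k)) < Real.sqrt (T₀ * l / 2)
  buyer_upper : ∀ k ∈ Finset.range (K + 1), ∀ t ≤ T,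
    1 ≤ (playRounds T K δ pick ω.1 ω.2 T₀ t (gridArm T₀ K ω.1 k)).card →
    1 * ∑ s ∈ playRounds T K δ pick ω.1 ω.2 T₀ t (gridArm T₀ K ω.1 k),
      (buyerShare (ω.1 s) (gridArm T₀ K ω.1 k) - expBuyerShare P (gridArm T₀ K ω.1 k))
      < Real.sqrt ((playRounds T K δ pick ω.1 ω.2 T₀ t (gridArm T₀ K ω.1 k)).card * l / 2)

theorem measure_not_isGood_le [IsProbabilityMeasure P] (hT₀ : 1 ≤ T₀) (hl₀ : 0 ≤ l₀)
    (hl : 0 ≤ l) :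
    ((valuationLaw P).prod learnerLaw) {ω | ¬ IsGood P T T₀ K δ pick q l₀ l ω}
      ≤ ((T₀ + 1) * (T₀ + 1) + (K + 1) * (T + 1) : ℕ) * ENNReal.ofReal (Real.exp (-l))
        + (T + 1 : ℕ) * ENNReal.ofReal (Real.exp (-l₀)) := by
  have hgrid : ∀ k, Measurable fun ω : (ℕ → Valuation n) × (ℕ → unitInterval) =>
      gridArm T₀ K ω.1 k := fun k => (measurable_gridArm T₀ K k).comp measurable_fst
  have hcover : Measurable fun ω : (ℕ → Valuation n) × (ℕ → unitInterval) =>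
      coverArm T₀ K q ω.1 := (measurable_coverArm T₀ K q).comp measurable_fst
  have h1 := measure_not_gapsAccurate_le P T₀ hl
  have h2 := measure_sellerShare_deviation_le P T₀ hcover
    (fun t ht => ignores_coverArm T₀ K ht q) (σ := -1) (by norm_num) hl₀ hT₀
  have h3 := measure_buyerShare_deviation_le P T T₀ K δ pick hcover
    (fun t ht => ignores_coverArm T₀ K ht q) (σ := -1) (by norm_num) hl₀
  have h4 := fun k => measure_sellerShare_deviation_le P T₀ (hgrid k)
    (fun t ht => ignores_gridArm T₀ K ht k) (σ := 1) (by norm_num) hl hT₀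
  have h5 := fun k => measure_buyerShare_deviation_le P T T₀ K δ pick (hgrid k)
    (fun t ht => ignores_gridArm T₀ K ht k) (σ := 1) (by norm_num) hl
  have h4' := (measure_biUnion_finset_le (μ := (valuationLaw P).prod learnerLaw)
    (Finset.range (K + 1)) _).trans (Finset.sum_le_sum fun k _ => h4 k)
  have h5' := (measure_biUnion_finset_le (μ := (valuationLaw P).prod learnerLaw)
    (Finset.range (K + 1)) _).trans (Finset.sum_le_sum fun k _ => h5 k)
  rw [Finset.sum_const, Finset.card_range, nsmul_eq_mul] at h4' h5'
  refine (measure_mono (t := ((_ ∪ _) ∪ (_ ∪ _)) ∪ _) ?_).trans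
    ((measure_union_le _ _).trans (add_le_add
      ((measure_union_le _ _).trans (add_le_add
        ((measure_union_le _ _).trans (add_le_add h1 h2))
        ((measure_union_le _ _).trans (add_le_add h3 h4')))) h5')) |>.trans (le_of_eq ?_)
  · intro ω hω
    by_contra hcon
    refine hω ?_
    simp only [Set.mem_union, Set.mem_ofPred_eq, Set.mem_iUnion, not_or, not_not, not_exists,
      not_and, not_le] at hcon
    obtain ⟨⟨⟨c1, c2⟩, c3, c4⟩, c5⟩ := hcon
    exact ⟨c1, c2, c3, c4, c5⟩
  · push_cast
    ring

end Good

/-! ### Regret on the good event -/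

section Regret

/-- The optimism widths add up to the square root of the number of rounds times the number of
arms. -/
theorem sum_inv_sqrt_count_le {ι : Type*} [Fintype ι] [DecidableEq ι] (k : ℕ → ι) {a b : ℕ}
    (hab : a ≤ b) :
    ∑ t ∈ Finset.Ico a b,
        1 / Real.sqrt (((Finset.Ico a t).filter fun s => k s = k t).card + 1)
      ≤ 2 * Real.sqrt (Fintype.card ι * (b - a : ℕ)) := by
  set N : ℕ → ι → ℕ := fun t i => ((Finset.Ico a t).filter fun s => k s = i).card with hN
  have hpot : ∑ t ∈ Finset.Ico a b, 1 / Real.sqrt (N t (k t) + 1)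
      ≤ ∑ i, 2 * Real.sqrt (N b i) := by
    induction b, hab using Nat.le_induction with
    | base => simp [hN]
    | succ b hab ih =>
      have hstep : ∀ i, N (b + 1) i = N b i + if i = k b then 1 else 0 := by
        intro i
        simp only [hN]
        rw [← Finset.insert_Ico_right_eq_Ico_add_one hab, Finset.filter_insert]
        by_cases hi : k b = i
        · rw [if_pos hi, if_pos hi.symm, Finset.card_insert_of_notMem (by simp)]
        · rw [if_neg hi, if_neg fun h => hi h.symm, add_zero]
      have hinc : 1 / Real.sqrt (N b (k b) + 1)
          ≤ 2 * Real.sqrt (N b (k b) + 1) - 2 * Real.sqrt (N b (k b)) := by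
        set x : ℝ := (N b (k b) : ℝ) with hx
        have hx0 : 0 ≤ x := Nat.cast_nonneg _
        have hs1 : 0 < Real.sqrt (x + 1) := Real.sqrt_pos.mpr (by linarith)
        rw [div_le_iff₀ hs1]
        nlinarith [Real.sq_sqrt hx0, Real.sq_sqrt (show 0 ≤ x + 1 by linarith),
          sq_nonneg (Real.sqrt (x + 1) - Real.sqrt x)]
      rw [Finset.sum_Ico_succ_top hab,
        ← Finset.add_sum_erase _ _ (Finset.mem_univ (k b))]
      rw [← Finset.add_sum_erase _ _ (Finset.mem_univ (k b))] at ih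
      have hrest : ∑ i ∈ Finset.univ.erase (k b), 2 * Real.sqrt (N (b + 1) i)
          = ∑ i ∈ Finset.univ.erase (k b), 2 * Real.sqrt (N b i) :=
        Finset.sum_congr rfl fun i hi => by
          rw [hstep i, if_neg (Finset.ne_of_mem_erase hi), add_zero]
      have htop : (N (b + 1) (k b) : ℝ) = N b (k b) + 1 := by
        rw [hstep, if_pos rfl]
        push_cast
        rfl
      rw [hrest, htop]
      linarith
  have hsum : ∑ i, (N b i : ℝ) = (b - a : ℕ) := by
    have h := Finset.card_eq_sum_card_fiberwise (s := Finset.Ico a b) (t := Finset.univ)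
      (f := k) (fun _ _ => Finset.mem_coe.mpr (Finset.mem_univ _))
    rw [Nat.card_Ico] at h
    rw [h]
    push_cast
    rfl
  refine hpot.trans ?_
  rw [← Finset.mul_sum]
  refine mul_le_mul_of_nonneg_left (Real.le_sqrt_of_sq_le ?_) (by norm_num)
  refine sq_sum_le_card_mul_sum_sq.trans (le_of_eq ?_)
  simp_rw [Real.sq_sqrt (Nat.cast_nonneg _)]
  rw [hsum, Finset.card_univ]

theorem sqrt_mul_div_two_eq {x : ℝ} (hx : 0 < x) (l : ℝ) :
    Real.sqrt (x * l / 2) = x * Real.sqrt (l / (2 * x)) := by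
  rw [show x * l / 2 = x ^ 2 * (l / (2 * x)) by field_simp, Real.sqrt_mul (by positivity),
    Real.sqrt_sq hx.le]

variable {n : ℕ} (P : Measure (Valuation n)) [IsProbabilityMeasure P] {T T₀ K : ℕ} {δ : ℝ}
  {pick : ℕ → Finset (Fin (K + 1)) → Fin (K + 1)} {q : unitInterval} {l : ℝ}
  {ω : (ℕ → Valuation n) × (ℕ → unitInterval)}

/-- Optimism: the index of the covering arm is at least its expected gain from trade. -/
theorem sbbGFT_le_ucbIndex (hT₀ : 1 ≤ T₀)
    (hω : IsGood P T T₀ K δ pick q (Real.log (2 * T * K / δ)) l ω) {t : ℕ} (h1 : 2 * T₀ ≤ t)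
    (h2 : t ≤ T) :
    sbbGFT P (coverArm T₀ K q ω.1) ≤ ucbIndex T T₀ K δ
      (history (algorithm n T T₀ K δ pick) ω.1 ω.2 t) (coverArm T₀ K q ω.1) := by
  have hT₀' : (0 : ℝ) < T₀ := by exact_mod_cast hT₀
  set r := coverArm T₀ K q ω.1 with hr
  rw [sbbGFT_eq_add]
  refine add_le_add ?_ ?_
  · have h := hω.seller_lower
    rw [← hr, sqrt_mul_div_two_eq hT₀', Finset.sum_sub_distrib, Finset.sum_const, Nat.card_Ico,
      nsmul_eq_mul, show 2 * T₀ - T₀ = T₀ by omega] at h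
    unfold gft1Bar
    rw [gft1Hat_history T K δ pick _ _ h1]
    refine le_of_mul_le_mul_left ?_ hT₀'
    rw [mul_add, ← mul_assoc, mul_one_div_cancel hT₀'.ne', one_mul]
    linarith
  · unfold gft2Bar
    rw [length_playsOf_history, gft2Hat_history]
    split_ifs with h0
    · exact expBuyerShare_le_one P r
    · have hpos : 1 ≤ (playRounds T K δ pick ω.1 ω.2 T₀ t r).card := Nat.one_le_iff_ne_zero.mpr h0
      have hpos' : (0 : ℝ) < (playRounds T K δ pick ω.1 ω.2 T₀ t r).card := by exact_mod_cast hpos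
      have h := hω.buyer_lower t h2 hpos
      rw [← hr, sqrt_mul_div_two_eq hpos', Finset.sum_sub_distrib, Finset.sum_const,
        nsmul_eq_mul] at h
      refine le_of_mul_le_mul_left ?_ hpos'
      rw [mul_add, ← mul_assoc, mul_one_div_cancel hpos'.ne', one_mul]
      linarith

/-- The index of a grid price exceeds its expected gain from trade by at most the widths of the
confidence intervals. -/
theorem ucbIndex_le (hT₀ : 1 ≤ T₀) (hl₀ : Real.log (2 * T * K / δ) ≤ l) (hl : 1 / 4 ≤ l)
    (hω : IsGood P T T₀ K δ pick q (Real.log (2 * T * K / δ)) l ω) {t : ℕ} (h1 : 2 * T₀ ≤ t)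
    (h2 : t ≤ T) {k : ℕ} (hk : k ∈ Finset.range (K + 1)) :
    ucbIndex T T₀ K δ (history (algorithm n T T₀ K δ pick) ω.1 ω.2 t) (gridArm T₀ K ω.1 k)
      ≤ sbbGFT P (gridArm T₀ K ω.1 k) + 2 * Real.sqrt (l / (2 * T₀)) +
        2 * Real.sqrt l / Real.sqrt
          ((playRounds T K δ pick ω.1 ω.2 T₀ t (gridArm T₀ K ω.1 k)).card + 1) := by
  have hT₀' : (0 : ℝ) < T₀ := by exact_mod_cast hT₀
  set r := gridArm T₀ K ω.1 k with hr
  rw [sbbGFT_eq_add]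
  have hseller : gft1Bar T T₀ K δ (history (algorithm n T T₀ K δ pick) ω.1 ω.2 t) r
      ≤ expSellerShare P r + 2 * Real.sqrt (l / (2 * T₀)) := by
    have h := hω.seller_upper k hk
    rw [← hr, sqrt_mul_div_two_eq hT₀', Finset.sum_sub_distrib, Finset.sum_const, Nat.card_Ico,
      nsmul_eq_mul, show 2 * T₀ - T₀ = T₀ by omega] at h
    have hmono : Real.sqrt (Real.log (2 * T * K / δ) / (2 * T₀)) ≤ Real.sqrt (l / (2 * T₀)) :=
      Real.sqrt_le_sqrt (by gcongr)
    unfold gft1Bar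
    rw [gft1Hat_history T K δ pick _ _ h1]
    have h' : 1 / (T₀ : ℝ) * ∑ s ∈ Finset.Ico T₀ (2 * T₀), sellerShareSample (ω.1 s) (ω.2 s) r
        ≤ expSellerShare P r + Real.sqrt (l / (2 * T₀)) := by
      refine le_of_mul_le_mul_left ?_ hT₀'
      rw [← mul_assoc, mul_one_div_cancel hT₀'.ne', one_mul]
      linarith
    linarith
  have hbuyer : gft2Bar T T₀ K δ (history (algorithm n T T₀ K δ pick) ω.1 ω.2 t) r
      ≤ expBuyerShare P r + 2 * Real.sqrt l / Real.sqrt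
          ((playRounds T K δ pick ω.1 ω.2 T₀ t r).card + 1) := by
    unfold gft2Bar
    rw [length_playsOf_history, gft2Hat_history]
    split_ifs with h0
    · rw [h0]
      have hb : 0 ≤ expBuyerShare P r := integral_nonneg fun v => (buyerShare_mem_Icc v r).1
      have hs : 1 / 2 ≤ Real.sqrt l := Real.le_sqrt_of_sq_le (by linarith)
      simp only [Nat.cast_zero, zero_add, Real.sqrt_one, div_one]
      linarith
    · have hpos : 1 ≤ (playRounds T K δ pick ω.1 ω.2 T₀ t r).card := Nat.one_le_iff_ne_zero.mpr h0
      have hpos1 : (1 : ℝ) ≤ (playRounds T K δ pick ω.1 ω.2 T₀ t r).card := by exact_mod_cast hpos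
      have h := hω.buyer_upper k hk t h2 hpos
      rw [← hr] at h
      set N : ℝ := ((playRounds T K δ pick ω.1 ω.2 T₀ t r).card : ℝ) with hN
      have hpos' : 0 < N := by linarith
      rw [sqrt_mul_div_two_eq hpos', Finset.sum_sub_distrib, Finset.sum_const,
        nsmul_eq_mul] at h
      have hmono : Real.sqrt (Real.log (2 * T * K / δ) / (2 * N)) ≤ Real.sqrt (l / (2 * N)) :=
        Real.sqrt_le_sqrt (by gcongr)
      have h' : 1 / N * ∑ s ∈ playRounds T K δ pick ω.1 ω.2 T₀ t r, buyerShare (ω.1 s) r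
          ≤ expBuyerShare P r + Real.sqrt (l / (2 * N)) := by
        refine le_of_mul_le_mul_left ?_ hpos'
        rw [← mul_assoc, mul_one_div_cancel hpos'.ne', one_mul]
        linarith
      have hwidth : Real.sqrt (l / (2 * N)) ≤ Real.sqrt l / Real.sqrt (N + 1) := by
        rw [← Real.sqrt_div (by linarith)]
        refine Real.sqrt_le_sqrt (div_le_div_of_nonneg_left (by linarith) (by linarith) ?_)
        linarith
      have : 2 * Real.sqrt l / Real.sqrt (N + 1) = 2 * (Real.sqrt l / Real.sqrt (N + 1)) := by ring
      linarith
  unfold ucbIndex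
  linarith

/-- Regret of a single round of the last phase against the covering arm. -/
theorem sbbGFT_coverArm_le (hpick : ∀ t A, A.Nonempty → pick t A ∈ A)
    (hT₀ : 1 ≤ T₀) (hl₀ : Real.log (2 * T * K / δ) ≤ l) (hl : 1 / 4 ≤ l)
    (hω : IsGood P T T₀ K δ pick q (Real.log (2 * T * K / δ)) l ω) {t : ℕ} (h1 : 2 * T₀ ≤ t)
    (h2 : t ≤ T) :
    sbbGFT P (coverArm T₀ K q ω.1)
      ≤ sbbGFT P (reserveAt (algorithm n T T₀ K δ pick) ω.1 ω.2 t) + 2 * Real.sqrt (l / (2 * T₀)) +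
        2 * Real.sqrt l / Real.sqrt (((Finset.Ico (2 * T₀) t).filter fun s =>
          armIndex T T₀ K δ pick ω.1 ω.2 s = armIndex T T₀ K δ pick ω.1 ω.2 t).card + 1) := by
  set h := history (algorithm n T T₀ K δ pick) ω.1 ω.2 t with hh
  set i := armIndex T T₀ K δ pick ω.1 ω.2 t with hi
  have hbest : i ∈ bestArms T T₀ K δ h := by
    refine hpick _ _ ?_
    obtain ⟨j, _, hj⟩ := (Finset.univ : Finset (Fin (K + 1))).exists_max_image
      (fun j => ucbIndex T T₀ K δ h (arm T₀ K h j)) ⟨0, Finset.mem_univ _⟩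
    exact ⟨j, Finset.mem_filter.mpr ⟨Finset.mem_univ _, fun j' => hj j' (Finset.mem_univ _)⟩⟩
  have hcmp := (Finset.mem_filter.mp hbest).2
    ⟨coverIndex T₀ K q ω.1, Nat.lt_succ_of_le (coverIndex_le T₀ K q ω.1)⟩
  simp only [hh, arm_history T K δ pick _ _ (show T₀ ≤ t by omega)] at hcmp
  have hopt := sbbGFT_le_ucbIndex P hT₀ hω h1 h2
  have hup := ucbIndex_le P hT₀ hl₀ hl hω h1 h2 (k := i) (Finset.mem_range.mpr i.2)
  rw [reserveAt_of_two_mul_le T K δ pick _ _ h1]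
  refine (hopt.trans hcmp).trans (hup.trans ?_)
  -- rounds with the same arm index have the same reserve price
  have hcard : ((Finset.Ico (2 * T₀) t).filter fun s =>
      armIndex T T₀ K δ pick ω.1 ω.2 s = i).card
      ≤ (playRounds T K δ pick ω.1 ω.2 T₀ t (gridArm T₀ K ω.1 i)).card := by
    refine Finset.card_le_card fun s hs => ?_
    obtain ⟨hs1, hs2⟩ := Finset.mem_filter.mp hs
    refine Finset.mem_filter.mpr ⟨hs1, ?_⟩
    rw [reserveAt_of_two_mul_le T K δ pick _ _ (Finset.mem_Ico.mp hs1).1, hs2]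
  gcongr

/-- The bound on the regret that holds on the good event. -/
def regretBound (T T₀ K : ℕ) (l : ℝ) : ℝ :=
  2 * T₀ + T * (1 / T + (2 + (T₀ : ℝ) / K + Real.sqrt (T₀ * l / 2)) / T₀
    + 2 * Real.sqrt (l / (2 * T₀))) + 4 * Real.sqrt l * Real.sqrt ((K + 1) * T)

theorem bddAbove_range_sbbGFT : BddAbove (Set.range (sbbGFT P)) :=
  ⟨1, by rintro _ ⟨q, rfl⟩; exact sbbGFT_le_one P q⟩

/-- Regret bound for rounds that are valued by nonnegative numbers `G t`, which agree with the
expected gain from trade of the posted reserve price in the last phase. -/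
theorem regret_le_regretBound (hpick : ∀ t A, A.Nonempty → pick t A ∈ A) (hT : 1 ≤ T)
    (hT₀ : 1 ≤ T₀) (hK : 1 ≤ K) (hl₀ : Real.log (2 * T * K / δ) ≤ l) (hl : 1 / 4 ≤ l)
    (hq : (⨆ q, sbbGFT P q) - 1 / T ≤ sbbGFT P q)
    (hω : IsGood P T T₀ K δ pick q (Real.log (2 * T * K / δ)) l ω) {G : ℕ → ℝ}
    (hG0 : ∀ t, 0 ≤ G t)
    (hG : ∀ t, 2 * T₀ ≤ t → G t = sbbGFT P (reserveAt (algorithm n T T₀ K δ pick) ω.1 ω.2 t)) :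
    T * (⨆ q, sbbGFT P q) - ∑ t ∈ Finset.range T, G t ≤ regretBound T T₀ K l := by
  set S := ⨆ q, sbbGFT P q with hS
  have hS1 : S ≤ 1 := ciSup_le fun q => sbbGFT_le_one P q
  have hS0 : 0 ≤ S := (sbbGFT_nonneg P 0).trans (le_ciSup (bddAbove_range_sbbGFT P) 0)
  set D : ℝ := 1 / T + (2 + (T₀ : ℝ) / K + Real.sqrt (T₀ * l / 2)) / T₀
    + 2 * Real.sqrt (l / (2 * T₀)) with hD
  have hD0 : 0 ≤ D := by positivity
  have hcov := sbbGFT_le_coverArm P T₀ K hT₀ hK hω.gaps q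
  set c : ℕ → ℝ := fun t => 1 / Real.sqrt (((Finset.Ico (2 * T₀) t).filter fun s =>
    armIndex T T₀ K δ pick ω.1 ω.2 s = armIndex T T₀ K δ pick ω.1 ω.2 t).card + 1) with hc
  have hround : ∀ t ∈ Finset.Ico (2 * T₀) T, S - G t ≤ D + 2 * Real.sqrt l * c t := by
    intro t ht
    obtain ⟨h1, h2⟩ := Finset.mem_Ico.mp ht
    have h := sbbGFT_coverArm_le P hpick hT₀ hl₀ hl hω h1 h2.le
    rw [hG t h1]
    simp only [hc, mul_one_div]
    linarith
  have hsub : ∑ t ∈ Finset.Ico (2 * T₀) T, G t ≤ ∑ t ∈ Finset.range T, G t :=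
    Finset.sum_le_sum_of_subset_of_nonneg
      (fun t ht => Finset.mem_range.mpr (Finset.mem_Ico.mp ht).2) fun t _ _ => hG0 t
  have hsum := Finset.sum_le_sum hround
  rw [Finset.sum_sub_distrib, Finset.sum_add_distrib, ← Finset.mul_sum, Finset.sum_const,
    Finset.sum_const, Nat.card_Ico, nsmul_eq_mul, nsmul_eq_mul] at hsum
  have hle : ((T - 2 * T₀ : ℕ) : ℝ) ≤ T := by exact_mod_cast Nat.sub_le _ _
  have hge : (T : ℝ) ≤ 2 * T₀ + ((T - 2 * T₀ : ℕ) : ℝ) := by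
    have : T ≤ 2 * T₀ + (T - 2 * T₀) := by omega
    exact_mod_cast this
  have hwidths : ∑ t ∈ Finset.Ico (2 * T₀) T, c t ≤ 2 * Real.sqrt ((K + 1) * T) := by
    rcases le_total (2 * T₀) T with h | h
    · refine (sum_inv_sqrt_count_le (fun s => armIndex T T₀ K δ pick ω.1 ω.2 s) h).trans ?_
      refine mul_le_mul_of_nonneg_left (Real.sqrt_le_sqrt ?_) (by norm_num)
      rw [Fintype.card_fin]
      push_cast
      gcongr
    · rw [Finset.Ico_eq_empty_of_le h, Finset.sum_empty]
      positivity
  have e1 : (T : ℝ) * S ≤ 2 * T₀ + ((T - 2 * T₀ : ℕ) : ℝ) * S := by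
    have h1 : (T : ℝ) * S ≤ (2 * T₀ + ((T - 2 * T₀ : ℕ) : ℝ)) * S :=
      mul_le_mul_of_nonneg_right hge hS0
    have h2 : 2 * (T₀ : ℝ) * S ≤ 2 * T₀ * 1 := mul_le_mul_of_nonneg_left hS1 (by positivity)
    linarith
  have e2 : ((T - 2 * T₀ : ℕ) : ℝ) * D ≤ T * D := mul_le_mul_of_nonneg_right hle hD0
  have e3 : 2 * Real.sqrt l * ∑ t ∈ Finset.Ico (2 * T₀) T, c t
      ≤ 2 * Real.sqrt l * (2 * Real.sqrt ((K + 1) * T)) :=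
    mul_le_mul_of_nonneg_left hwidths (by positivity)
  have : regretBound T T₀ K l = 2 * T₀ + T * D + 4 * Real.sqrt l * Real.sqrt ((K + 1) * T) := rfl
  rw [this]
  linarith

omit [IsProbabilityMeasure P] in
/-- In the last phase the algorithm plays strongly budget-balanced mechanisms. -/
theorem expGFT_priceRuleAt_eq {t : ℕ} (h : 2 * T₀ ≤ t) :
    expGFT P (priceRuleAt (algorithm n T T₀ K δ pick) ω.1 ω.2 t)
        (reserveAt (algorithm n T T₀ K δ pick) ω.1 ω.2 t)
      = sbbGFT P (reserveAt (algorithm n T T₀ K δ pick) ω.1 ω.2 t) := by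
  unfold sbbGFT
  congr 1
  funext b
  exact priceRuleAt_of_two_mul_le T K δ pick ω.1 ω.2 h b

/-- Every mechanism that the algorithm plays offers the seller at most the highest bid, if this
bid reaches the reserve price. -/
theorem priceRuleAt_le_highest (t : ℕ) (b : Fin n → unitInterval)
    (hb : reserveAt (algorithm n T T₀ K δ pick) ω.1 ω.2 t ≤ highest b) :
    priceRuleAt (algorithm n T T₀ K δ pick) ω.1 ω.2 t b ≤ highest b := by
  rcases lt_or_ge t T₀ with h1 | h1
  · rw [priceRuleAt_of_lt T K δ pick _ _ h1]
    exact secondHighest_le_highest b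
  rcases lt_or_ge t (2 * T₀) with h2 | h2
  · rw [priceRuleAt_of_lt_two_mul T K δ pick _ _ h1 h2]
    rwa [reserveAt_of_lt_two_mul T K δ pick _ _ h1 h2] at hb
  · rw [priceRuleAt_of_two_mul_le T K δ pick _ _ h2]
    exact max_le hb (secondHighest_le_highest b)

omit [IsProbabilityMeasure P] in
theorem expGFT_priceRuleAt_nonneg (t : ℕ) :
    0 ≤ expGFT P (priceRuleAt (algorithm n T T₀ K δ pick) ω.1 ω.2 t)
        (reserveAt (algorithm n T T₀ K δ pick) ω.1 ω.2 t) :=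
  expGFT_nonneg P _ _ (priceRuleAt_le_highest t)

end Regret

/-! ### Probability of the good event -/

section Probability

variable {n : ℕ} (P : Measure (Valuation n)) [IsProbabilityMeasure P] {T T₀ K : ℕ} {δ : ℝ}
  {pick : ℕ → Finset (Fin (K + 1)) → Fin (K + 1)}

/-- The logarithm of the inverse failure probability that is used for the estimates which are not
built into the algorithm. -/
def confidenceLevel (T T₀ K : ℕ) (δ : ℝ) : ℝ :=
  Real.log (4 * (K + 1) ^ 2 * (T + 1) ^ 2 * (T₀ + 1) ^ 2 / δ)

theorem le_confidenceLevel_arg (hδ : 0 < δ) (z : ℝ) (hz : z ≤ 4 * (K + 1) ^ 2 * (T + 1) ^ 2) :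
    z / δ ≤ 4 * (K + 1) ^ 2 * (T + 1) ^ 2 * (T₀ + 1) ^ 2 / δ := by
  refine div_le_div_of_nonneg_right (hz.trans ?_) hδ.le
  refine le_mul_of_one_le_right (by positivity) (one_le_pow₀ ?_)
  have : (0 : ℝ) ≤ T₀ := Nat.cast_nonneg _
  linarith

theorem quarter_le_confidenceLevel (hδ : 0 < δ) (hδ' : δ < 1 / 3) :
    1 / 4 ≤ confidenceLevel T T₀ K δ := by
  have hK : (0 : ℝ) ≤ K := Nat.cast_nonneg _
  have hT : (0 : ℝ) ≤ T := Nat.cast_nonneg _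
  have harg := le_confidenceLevel_arg (T := T) (T₀ := T₀) (K := K) hδ 4 (by
    have h1 : (1 : ℝ) ≤ (K + 1) ^ 2 := one_le_pow₀ (by linarith)
    have h2 : (1 : ℝ) ≤ (T + 1) ^ 2 := one_le_pow₀ (by linarith)
    nlinarith)
  have h4 : (4 : ℝ) ≤ 4 / δ := by
    rw [le_div_iff₀ hδ]
    linarith
  have hpos : (0 : ℝ) < 4 := by norm_num
  have hlog := Real.log_le_log hpos (h4.trans harg)
  have h := Real.one_sub_inv_le_log_of_pos hpos
  unfold confidenceLevel
  norm_num at h ⊢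
  linarith

theorem log_le_confidenceLevel (hδ : 0 < δ) (hT : 1 ≤ T) (hK : 1 ≤ K) :
    Real.log (2 * T * K / δ) ≤ confidenceLevel T T₀ K δ := by
  have hK' : (1 : ℝ) ≤ K := by exact_mod_cast hK
  have hT' : (1 : ℝ) ≤ T := by exact_mod_cast hT
  refine Real.log_le_log (by positivity) (le_confidenceLevel_arg hδ _ ?_)
  have h1 : (K : ℝ) ≤ (K + 1) ^ 2 := by nlinarith
  have h2 : (T : ℝ) ≤ (T + 1) ^ 2 := by nlinarith
  have h3 : (T : ℝ) * K ≤ (T + 1) ^ 2 * (K + 1) ^ 2 := by gcongr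
  nlinarith

/-- Both regrets are at most `regretBound` up to an event of probability `2 * δ / K`. The factor
`1 / K` comes from the fact that the confidence level of the algorithm allows for a union bound
over all grid prices, whereas only one of them must not be underestimated. -/
theorem measure_regret_gt_le (hpick : ∀ t A, A.Nonempty → pick t A ∈ A) (hT : 1 ≤ T)
    (hT₀ : 1 ≤ T₀) (hK : 1 ≤ K) (hδ : 0 < δ) (hδ' : δ < 1 / 3) :
    ((valuationLaw P).prod learnerLaw) {ω | ¬
      (regret P (algorithm n T T₀ K δ pick) T ω.1 ω.2
          ≤ regretBound T T₀ K (confidenceLevel T T₀ K δ) ∧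
        deployedRegret P (algorithm n T T₀ K δ pick) T ω.1 ω.2
          ≤ regretBound T T₀ K (confidenceLevel T T₀ K δ))} ≤ ENNReal.ofReal (2 * δ / K) := by
  have hK' : (1 : ℝ) ≤ K := by exact_mod_cast hK
  have hT' : (1 : ℝ) ≤ T := by exact_mod_cast hT
  have hT₀' : (1 : ℝ) ≤ T₀ := by exact_mod_cast hT₀
  set l := confidenceLevel T T₀ K δ with hl
  have hl4 : 1 / 4 ≤ l := quarter_le_confidenceLevel hδ hδ'
  have hl₀ : Real.log (2 * T * K / δ) ≤ l := log_le_confidenceLevel hδ hT hK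
  have hl₀0 : 0 ≤ Real.log (2 * T * K / δ) := by
    refine Real.log_nonneg ((one_le_div hδ).mpr ?_)
    nlinarith
  -- a nearly optimal reserve price
  obtain ⟨q, hq⟩ : ∃ q, (⨆ q, sbbGFT P q) - 1 / T < sbbGFT P q := by
    refine exists_lt_of_lt_ciSup ?_
    have : (0 : ℝ) < 1 / T := by positivity
    linarith
  refine (measure_mono (t := {ω | ¬ IsGood P T T₀ K δ pick q (Real.log (2 * T * K / δ)) l ω})
    ?_).trans ((measure_not_isGood_le P T T₀ K δ pick q _ l hT₀ hl₀0 (by linarith)).trans ?_)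
  · intro ω hω hgood
    refine hω ⟨?_, ?_⟩
    · exact regret_le_regretBound P hpick hT hT₀ hK hl₀ hl4 hq.le hgood
        (fun t => sbbGFT_nonneg P _) fun t _ => rfl
    · exact regret_le_regretBound P hpick hT hT₀ hK hl₀ hl4 hq.le hgood
        (fun t => expGFT_priceRuleAt_nonneg P t) fun t ht => expGFT_priceRuleAt_eq P ht
  · have e0 : Real.exp (-Real.log (2 * T * K / δ)) = δ / (2 * T * K) := by
      rw [Real.exp_neg, Real.exp_log (by positivity), inv_div]
    have e1 : Real.exp (-l) = δ / (4 * (K + 1) ^ 2 * (T + 1) ^ 2 * (T₀ + 1) ^ 2) := by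
      rw [hl, confidenceLevel, Real.exp_neg, Real.exp_log (by positivity), inv_div]
    rw [e0, e1, ← ENNReal.ofReal_natCast, ← ENNReal.ofReal_natCast,
      ← ENNReal.ofReal_mul (by positivity), ← ENNReal.ofReal_mul (by positivity),
      ← ENNReal.ofReal_add (by positivity) (by positivity)]
    refine ENNReal.ofReal_le_ofReal ?_
    push_cast
    have b0 : ((T : ℝ) + 1) * (δ / (2 * T * K)) ≤ δ / K := by
      rw [mul_div_assoc', div_le_div_iff₀ (by positivity) (by positivity)]
      have : ((T : ℝ) + 1) * (δ * K) ≤ (2 * T) * (δ * K) := by gcongr; linarith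
      linarith
    have b1 : (((T₀ : ℝ) + 1) * (T₀ + 1) + (K + 1) * (T + 1))
        * (δ / (4 * (K + 1) ^ 2 * (T + 1) ^ 2 * (T₀ + 1) ^ 2)) ≤ δ / K := by
      set A : ℝ := ((T₀ : ℝ) + 1) ^ 2 with hA
      set B : ℝ := ((K : ℝ) + 1) * (T + 1) with hB
      have hA1 : 1 ≤ A := one_le_pow₀ (by linarith)
      have hB1 : 1 ≤ B := by nlinarith
      have hKB : (K : ℝ) ≤ B := by nlinarith
      have hsum : A + B ≤ 4 * (A * B) := by nlinarith
      have : (4 * ((K : ℝ) + 1) ^ 2 * (T + 1) ^ 2 * (T₀ + 1) ^ 2) = 4 * (A * B) * B := by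
        rw [hA, hB]; ring
      rw [this, ← sq, mul_div_assoc', div_le_div_iff₀ (by positivity) (by positivity)]
      calc (A + B) * δ * K ≤ (4 * (A * B)) * δ * B := by gcongr
        _ = δ * (4 * (A * B) * B) := by ring
    have : 2 * δ / K = δ / K + δ / K := by ring
    linarith

theorem ofReal_one_sub_le_measure {Ω : Type*} [MeasurableSpace Ω] {μ : Measure Ω}
    [IsProbabilityMeasure μ] {S : Set Ω} {ε : ℝ} (hε : 0 ≤ ε) (h : μ Sᶜ ≤ ENNReal.ofReal ε) :
    ENNReal.ofReal (1 - ε) ≤ μ S := by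
  rw [ENNReal.ofReal_sub 1 hε, ENNReal.ofReal_one, tsub_le_iff_right]
  calc (1 : ENNReal) = μ (S ∪ Sᶜ) := by rw [Set.union_compl_self, measure_univ]
    _ ≤ μ S + μ Sᶜ := measure_union_le _ _
    _ ≤ μ S + ENNReal.ofReal ε := by gcongr

theorem integral_le_add_mul_measure {Ω : Type*} [MeasurableSpace Ω] {μ : Measure Ω}
    [IsProbabilityMeasure μ] {A : Set Ω} (hA : MeasurableSet A) {f : Ω → ℝ} {B D η : ℝ}
    (hB : 0 ≤ B) (hD : 0 ≤ D) (hf : Integrable f μ) (hη : 0 ≤ η)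
    (hfB : ∀ x ∉ A, f x ≤ B) (hfD : ∀ x, f x ≤ D)
    (hμ : μ A ≤ ENNReal.ofReal η) : ∫ x, f x ∂μ ≤ B + D * η := by
  have hind : Integrable (A.indicator fun _ => D) μ := (integrable_const D).indicator hA
  calc ∫ x, f x ∂μ ≤ ∫ x, (B + A.indicator (fun _ => D) x) ∂μ := by
        refine integral_mono hf ((integrable_const B).add hind) fun x => ?_
        by_cases hx : x ∈ A
        · simp only [Set.indicator_of_mem hx]
          linarith [hfD x]
        · simp only [Set.indicator_of_notMem hx, add_zero]
          exact hfB x hx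
    _ = B + D * μ.real A := by
        rw [integral_add (integrable_const B) hind, integral_indicator_const _ hA]
        simp [mul_comm]
    _ ≤ B + D * η := by
        have : μ.real A ≤ η := ENNReal.toReal_le_of_le_ofReal hη hμ
        gcongr

/-- Bounds in expectation over the second coordinate, from an exceptional set of small measure
in a product: by Markov's inequality, few first coordinates see a large part of that set. -/
theorem measure_compl_integral_le {Ω₁ Ω₂ : Type*} [MeasurableSpace Ω₁] [MeasurableSpace Ω₂]
    {μ : Measure Ω₁} {ν : Measure Ω₂} [IsProbabilityMeasure μ] [IsProbabilityMeasure ν]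
    {f g : Ω₁ → Ω₂ → ℝ} {B D η ε : ℝ} (hB : 0 ≤ B) (hD : 0 ≤ D) (hη : 0 < η)
    (hf : ∀ x, Integrable (f x) ν) (hg : ∀ x, Integrable (g x) ν)
    (hfD : ∀ x y, f x y ≤ D) (hgD : ∀ x y, g x y ≤ D)
    (hbad : (μ.prod ν) {z | ¬ (f z.1 z.2 ≤ B ∧ g z.1 z.2 ≤ B)} ≤ ENNReal.ofReal (ε * η)) :
    μ {x | ∫ y, f x y ∂ν ≤ B + D * η ∧ ∫ y, g x y ∂ν ≤ B + D * η}ᶜ ≤ ENNReal.ofReal ε := by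
  -- the exceptional set need not be measurable
  set E := toMeasurable (μ.prod ν) {z | ¬ (f z.1 z.2 ≤ B ∧ g z.1 z.2 ≤ B)} with hE
  have hEm : MeasurableSet E := measurableSet_toMeasurable _ _
  have hEsub : ∀ x y, (x, y) ∉ E → f x y ≤ B ∧ g x y ≤ B := by
    intro x y h
    by_contra hcon
    exact h (subset_toMeasurable _ _ hcon)
  have hmeas : Measurable fun x => ν (Prod.mk x ⁻¹' E) := measurable_measure_prodMk_left hEm
  have hint : ∫⁻ x, ν (Prod.mk x ⁻¹' E) ∂μ ≤ ENNReal.ofReal (ε * η) := by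
    rw [← Measure.prod_apply hEm, hE, measure_toMeasurable]
    exact hbad
  have hη0 : ENNReal.ofReal η ≠ 0 := by simpa using hη
  refine (measure_mono (t := {x | ENNReal.ofReal η ≤ ν (Prod.mk x ⁻¹' E)}) ?_).trans
    ((meas_ge_le_lintegral_div hmeas.aemeasurable hη0 ENNReal.ofReal_ne_top).trans ?_)
  · intro x hx
    by_contra hcon
    have hlt : ν (Prod.mk x ⁻¹' E) ≤ ENNReal.ofReal η := (not_le.mp hcon).le
    have hxm : MeasurableSet (Prod.mk x ⁻¹' E) := measurable_prodMk_left hEm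
    exact hx ⟨integral_le_add_mul_measure hxm hB hD (hf x) hη.le
        (fun y hy => (hEsub x y hy).1) (hfD x) hlt,
      integral_le_add_mul_measure hxm hB hD (hg x) hη.le
        (fun y hy => (hEsub x y hy).2) (hgD x) hlt⟩
  · rw [ENNReal.div_le_iff hη0 ENNReal.ofReal_ne_top, ← ENNReal.ofReal_mul' hη.le]
    exact hint

theorem regret_le_horizon {π : Policy n} (v : ℕ → Valuation n) (u : ℕ → unitInterval) :
    regret P π T v u ≤ T := by
  have h1 : (⨆ q, sbbGFT P q) ≤ 1 := ciSup_le fun q => sbbGFT_le_one P q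
  have h2 : 0 ≤ ∑ t ∈ Finset.range T, sbbGFT P (reserveAt π v u t) :=
    Finset.sum_nonneg fun t _ => sbbGFT_nonneg P _
  have h3 : (T : ℝ) * (⨆ q, sbbGFT P q) ≤ T * 1 := by gcongr
  unfold regret
  linarith

theorem deployedRegret_le_horizon (v : ℕ → Valuation n) (u : ℕ → unitInterval) :
    deployedRegret P (algorithm n T T₀ K δ pick) T v u ≤ T := by
  have h1 : (⨆ q, sbbGFT P q) ≤ 1 := ciSup_le fun q => sbbGFT_le_one P q
  have h2 := Finset.sum_nonneg fun t (_ : t ∈ Finset.range T) =>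
    expGFT_priceRuleAt_nonneg P (T := T) (T₀ := T₀) (K := K) (δ := δ) (pick := pick)
      (ω := (v, u)) t
  have h3 : (T : ℝ) * (⨆ q, sbbGFT P q) ≤ T * 1 := by gcongr
  unfold deployedRegret
  linarith

end Probability

/-! ### Integrability of the regret over the learner's draws -/

section Integrability

variable {n : ℕ} (P : Measure (Valuation n)) [IsProbabilityMeasure P] (T T₀ K : ℕ) (δ : ℝ)
  (pick : ℕ → Finset (Fin (K + 1)) → Fin (K + 1)) (v : ℕ → Valuation n)

theorem measurable_sbbGFT : Measurable (sbbGFT P) := by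
  rw [show sbbGFT P = fun q => expSellerShare P q + expBuyerShare P q from
    funext (sbbGFT_eq_add P)]
  exact (measurable_expSellerShare P).add (measurable_expBuyerShare P)

theorem measurable_reserveAt_draws (t : ℕ) :
    Measurable fun u => reserveAt (algorithm n T T₀ K δ pick) v u t :=
  (measurable_reserveAt T T₀ K δ pick t).comp measurable_prodMk_left

theorem expGFT_le_one {p : (Fin n → unitInterval) → unitInterval} {q : unitInterval}
    (h : ∀ b, q ≤ highest b → p b ≤ highest b) : expGFT P p q ≤ 1 := by
  calc expGFT P p q ≤ ∫ _, (1 : ℝ) ∂P :=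
        integral_mono_of_nonneg (Filter.Eventually.of_forall fun v => gft_nonneg (h v.1))
          (integrable_const _) (Filter.Eventually.of_forall fun v => gft_le_one _ _ _)
    _ = 1 := by simp

/-- Expected gain from trade if the same price is posted on both sides, as a function of it. -/
theorem measurable_expGFT_const : Measurable fun p : unitInterval => expGFT P (fun _ => p) p := by
  have hgft : Measurable fun z : unitInterval × Valuation n => gft z.2 z.1 z.1 := by
    have h1 : MeasurableSet {z : unitInterval × Valuation n | z.2.2 ≤ z.1} :=
      measurableSet_le measurable_snd.snd measurable_fst
    have h2 : MeasurableSet {z : unitInterval × Valuation n | z.1 ≤ highest z.2.1} :=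
      measurableSet_le measurable_fst (measurable_highest_comp measurable_snd)
    exact Measurable.ite (h1.inter h2) ((measurable_highest_comp measurable_snd).subtype_val.sub
      measurable_snd.snd.subtype_val) measurable_const
  exact (hgft.stronglyMeasurable.integral_prod_right (ν := P)).measurable

theorem measurable_expGFT_priceRuleAt (t : ℕ) :
    Measurable fun u => expGFT P (priceRuleAt (algorithm n T T₀ K δ pick) v u t)
      (reserveAt (algorithm n T T₀ K δ pick) v u t) := by
  rcases lt_or_ge t T₀ with h1 | h1
  · have h : ∀ u, priceRuleAt (algorithm n T T₀ K δ pick) v u t = secondHighest := fun u =>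
      funext (priceRuleAt_of_lt T K δ pick v u h1)
    simp only [h, reserveAt_of_lt T K δ pick v _ h1]
    exact measurable_const
  rcases lt_or_ge t (2 * T₀) with h2 | h2
  · have h : ∀ u, priceRuleAt (algorithm n T T₀ K δ pick) v u t = fun _ => u t := fun u =>
      funext (priceRuleAt_of_lt_two_mul T K δ pick v u h1 h2)
    simp only [h, reserveAt_of_lt_two_mul T K δ pick v _ h1 h2]
    exact (measurable_expGFT_const P).comp (measurable_pi_apply t)
  · have h := fun u => expGFT_priceRuleAt_eq P (T := T) (K := K) (δ := δ) (pick := pick)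
      (ω := (v, u)) h2
    simp only at h
    simp only [h]
    exact (measurable_sbbGFT P).comp (measurable_reserveAt_draws T T₀ K δ pick v t)

theorem integrable_regret :
    Integrable (regret P (algorithm n T T₀ K δ pick) T v) learnerLaw :=
  (integrable_const _).sub (integrable_finsetSum _ fun t _ => Integrable.of_mem_Icc 0 1
    ((measurable_sbbGFT P).comp (measurable_reserveAt_draws T T₀ K δ pick v t)).aemeasurable
    (Filter.Eventually.of_forall fun _ => ⟨sbbGFT_nonneg P _, sbbGFT_le_one P _⟩))

theorem integrable_deployedRegret :
    Integrable (deployedRegret P (algorithm n T T₀ K δ pick) T v) learnerLaw :=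
  (integrable_const _).sub (integrable_finsetSum _ fun t _ => Integrable.of_mem_Icc 0 1
    (measurable_expGFT_priceRuleAt P T T₀ K δ pick v t).aemeasurable
    (Filter.Eventually.of_forall fun u => ⟨expGFT_priceRuleAt_nonneg P (ω := (v, u)) t,
      expGFT_le_one P (priceRuleAt_le_highest (ω := (v, u)) t)⟩))

end Integrability

/-! ### Rates -/

section Rates

theorem one_le_logFactor (T : ℕ) {δ : ℝ} (hδ : 0 < δ) : 1 ≤ logFactor T δ := by
  have h : 0 ≤ Real.log (1 + T / δ) := Real.log_nonneg (by
    have : 0 ≤ (T : ℝ) / δ := by positivity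
    linarith)
  unfold logFactor
  linarith

theorem pos_of_hasOrder {c : ℝ} (hc : 0 < c) {a T : ℕ} (hT : 1 ≤ T) {δ : ℝ} (hδ : 0 < δ) {e : ℝ}
    {N : ℕ} (h : HasOrder c a T δ e N) : 1 ≤ N := by
  have hT' : (0 : ℝ) < T := by exact_mod_cast hT
  have hL : 0 < logFactor T δ := lt_of_lt_of_le one_pos (one_le_logFactor T hδ)
  have : (0 : ℝ) < N := lt_of_lt_of_le (by positivity) h.1
  exact_mod_cast this

theorem log_one_add_mul_le {c : ℝ} (hc : 0 < c) (a : ℕ) {T : ℕ} (hT : 1 ≤ T) {δ : ℝ} (hδ : 0 < δ)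
    (hδ' : δ < 1 / 3) {N : ℝ} (hN : 0 ≤ N) (h : N ≤ c * logFactor T δ ^ a * T) :
    Real.log (N + 1) ≤ (c + a + 1) * logFactor T δ := by
  have hT' : (1 : ℝ) ≤ T := by exact_mod_cast hT
  set L := logFactor T δ with hL
  have hL1 : 1 ≤ L := one_le_logFactor T hδ
  have hLa : 1 ≤ L ^ a := one_le_pow₀ hL1
  have hlogT : Real.log (1 + T) ≤ L := by
    have : Real.log (1 + T) ≤ Real.log (1 + T / δ) := by
      refine Real.log_le_log (by positivity) ?_
      have : (T : ℝ) ≤ T / δ := le_div_self (by positivity) hδ (by linarith)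
      linarith
    rw [hL, logFactor]
    linarith
  have hle : N + 1 ≤ (1 + c) * L ^ a * (1 + T) := by
    have h1 : 0 ≤ c * L ^ a := by positivity
    have h2 : (1 + (T : ℝ)) * 1 ≤ (1 + T) * L ^ a := by gcongr
    linarith
  have hlogc : Real.log (1 + c) ≤ c := by
    have := Real.log_le_sub_one_of_pos (show 0 < 1 + c by linarith)
    linarith
  have hlogL : Real.log L ≤ L := (Real.log_le_sub_one_of_pos (by linarith)).trans (by linarith)
  calc Real.log (N + 1) ≤ Real.log ((1 + c) * L ^ a * (1 + T)) :=
        Real.log_le_log (by linarith) hle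
    _ = Real.log (1 + c) + a * Real.log L + Real.log (1 + T) := by
        rw [Real.log_mul (by positivity) (by positivity), Real.log_mul (by positivity)
          (by positivity), Real.log_pow]
    _ ≤ c * L + a * L + L := by
        have h1 : c ≤ c * L := le_mul_of_one_le_right hc.le hL1
        have h2 : (a : ℝ) * Real.log L ≤ a * L := by gcongr
        linarith
    _ = _ := by ring

theorem confidenceLevel_le {c : ℝ} (hc : 0 < c) {a T T₀ K : ℕ} (hT : 1 ≤ T) {δ : ℝ} (hδ : 0 < δ)
    (hδ' : δ < 1 / 3) (hT₀ : (T₀ : ℝ) ≤ c * logFactor T δ ^ a * T)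
    (hK : (K : ℝ) ≤ c * logFactor T δ ^ a * T) :
    confidenceLevel T T₀ K δ ≤ (10 + 4 * c + 4 * a) * logFactor T δ := by
  have hT' : (1 : ℝ) ≤ T := by exact_mod_cast hT
  have h1 := log_one_add_mul_le hc a hT hδ hδ' (Nat.cast_nonneg _) hT₀
  have h2 := log_one_add_mul_le hc a hT hδ hδ' (Nat.cast_nonneg _) hK
  set L := logFactor T δ with hL
  have hL1 : 1 ≤ L := one_le_logFactor T hδ
  have h3 : Real.log (T + 1) ≤ L := by
    have : Real.log ((T : ℝ) + 1) ≤ Real.log (1 + T / δ) := by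
      refine Real.log_le_log (by positivity) ?_
      have : (T : ℝ) ≤ T / δ := le_div_self (by positivity) hδ (by linarith)
      linarith
    rw [hL, logFactor]
    linarith
  have h4 : -Real.log δ ≤ L := by
    have : Real.log δ⁻¹ ≤ Real.log (1 + T / δ) := by
      refine Real.log_le_log (by positivity) ?_
      have : δ⁻¹ ≤ T / δ := by
        rw [div_eq_mul_inv]
        exact le_mul_of_one_le_left (by positivity) hT'
      linarith
    rw [Real.log_inv] at this
    rw [hL, logFactor]
    linarith
  have h5 : Real.log 4 ≤ 3 := by
    have := Real.log_le_sub_one_of_pos (show (0 : ℝ) < 4 by norm_num)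
    linarith
  unfold confidenceLevel
  rw [Real.log_div (by positivity) hδ.ne', Real.log_mul (by positivity) (by positivity),
    Real.log_mul (by positivity) (by positivity), Real.log_mul (by positivity) (by positivity),
    Real.log_pow, Real.log_pow, Real.log_pow]
  push_cast
  linarith

/-- The regret bound in terms of the cube root `x` of `T`, if `T₀` and `K` agree with `x ^ 2` and
`x` up to the factor `y`. -/
theorem regretBound_add_le {T T₀ K : ℕ} {l x y : ℝ} (hx : 1 ≤ x) (hy : 0 < y) (hl : 0 ≤ l)
    (hT : (T : ℝ) = x ^ 3) (hT₀ : x ^ 2 / y ≤ T₀) (hT₀' : (T₀ : ℝ) ≤ y * x ^ 2)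
    (hK : x / y ≤ K) (hK' : (K : ℝ) ≤ y * x) (hK1 : 1 ≤ K) :
    regretBound T T₀ K l + T * (1 / K) ≤ (13 * y + 1 + 7 * l) * x ^ 2 := by
  have hx0 : 0 < x := by linarith
  have hT₀0 : (0 : ℝ) < T₀ := lt_of_lt_of_le (by positivity) hT₀
  have hK1' : (1 : ℝ) ≤ K := by exact_mod_cast hK1
  have hK0 : (0 : ℝ) < K := by linarith
  rw [div_le_iff₀ hy] at hT₀ hK
  have hxx : x ≤ x ^ 2 := by nlinarith
  -- the width of the confidence interval of the seller's share
  have hw : Real.sqrt (l / (2 * T₀)) ≤ (l + y) / x := by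
    refine Real.sqrt_le_iff.mpr ⟨by positivity, ?_⟩
    rw [div_pow, div_le_div_iff₀ (by positivity) (by positivity)]
    calc l * x ^ 2 ≤ l * (T₀ * y) := by gcongr
      _ = (l * y) * T₀ := by ring
      _ ≤ (l + y) ^ 2 * T₀ := by gcongr; nlinarith
      _ ≤ (l + y) ^ 2 * (2 * T₀) := by
        have : 0 ≤ (l + y) ^ 2 * T₀ := by positivity
        linarith
  have hTw : (T : ℝ) * Real.sqrt (l / (2 * T₀)) ≤ (l + y) * x ^ 2 := by
    calc (T : ℝ) * Real.sqrt (l / (2 * T₀)) ≤ x ^ 3 * ((l + y) / x) := by rw [hT]; gcongr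
      _ = (l + y) * x ^ 2 := by field_simp
  have harms : Real.sqrt l * Real.sqrt ((K + 1) * T) ≤ (l + y) * x ^ 2 := by
    rw [← Real.sqrt_mul hl]
    refine Real.sqrt_le_iff.mpr ⟨by positivity, ?_⟩
    have h1 : ((K : ℝ) + 1) * T ≤ 2 * (y * x) * x ^ 3 := by
      rw [hT]
      gcongr
      linarith
    calc l * ((K + 1) * T) ≤ l * (2 * (y * x) * x ^ 3) := by gcongr
      _ = (2 * l * y) * x ^ 4 := by ring
      _ ≤ (l + y) ^ 2 * x ^ 4 := by gcongr; nlinarith [sq_nonneg (l - y)]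
      _ = ((l + y) * x ^ 2) ^ 2 := by ring
  have hTK : (T : ℝ) * (1 / K) ≤ y * x ^ 2 := by
    rw [mul_one_div, div_le_iff₀ hK0, hT]
    calc x ^ 3 = x ^ 2 * x := by ring
      _ ≤ x ^ 2 * (K * y) := by gcongr
      _ = y * x ^ 2 * K := by ring
  have hTT₀ : (T : ℝ) * (2 / T₀) ≤ 2 * y * x ^ 2 := by
    rw [mul_div_assoc', div_le_iff₀ hT₀0, hT]
    calc x ^ 3 * 2 = 2 * x * x ^ 2 := by ring
      _ ≤ 2 * x ^ 2 * (T₀ * y) := by gcongr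
      _ = 2 * y * x ^ 2 * T₀ := by ring
  have hT0 : (0 : ℝ) < T := by rw [hT]; positivity
  have hone : (T : ℝ) * (1 / T) ≤ x ^ 2 := by
    rw [mul_one_div_cancel hT0.ne']
    nlinarith
  have hexp : regretBound T T₀ K l = 2 * T₀ + T * (1 / T) + T * (2 / T₀) + T * (1 / K)
      + 3 * (T * Real.sqrt (l / (2 * T₀))) + 4 * (Real.sqrt l * Real.sqrt ((K + 1) * T)) := by
    unfold regretBound
    rw [sqrt_mul_div_two_eq hT₀0]
    field_simp
    ring
  rw [hexp]
  linarith

end Rates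

end TwoSidedMarket

end

/-! ### The regret bound -/

theorem mainTheorem1 (c : ℝ) (hc : 0 < c) (a : ℕ) :
    ∃ (C : ℝ) (m : ℕ),
      ∀ (n : ℕ) (_ : 1 ≤ n)
        (P : Measure (TwoSidedMarket.Valuation n)) [IsProbabilityMeasure P]
        (T : ℕ) (_ : 1 ≤ T) (δ : ℝ) (_ : 0 < δ) (T₀ K : ℕ)
        (_ : TwoSidedMarket.HasOrder c a T δ (2 / 3) T₀)
        (_ : TwoSidedMarket.HasOrder c a T δ (1 / 3) K)
        (pick : ℕ → Finset (Fin (K + 1)) → Fin (K + 1))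
        (_ : ∀ t A, A.Nonempty → pick t A ∈ A),
        let π : TwoSidedMarket.Policy n := TwoSidedMarket.algorithm n T T₀ K δ pick
        let bound : ℝ := C * TwoSidedMarket.logFactor T δ ^ m * (T : ℝ) ^ (2 / 3 : ℝ)
        -- every mechanism played is weakly budget balanced
        (∀ (v : ℕ → TwoSidedMarket.Valuation n) (u : ℕ → unitInterval) (t : ℕ),
          0 ≤ TwoSidedMarket.rev (v t) (TwoSidedMarket.priceAt π v u t)
            (TwoSidedMarket.reserveAt π v u t)) ∧
        -- the realized regret, over valuations and learner
        ENNReal.ofReal (1 - 3 * δ) ≤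
          ((TwoSidedMarket.valuationLaw P).prod TwoSidedMarket.learnerLaw)
            {ω | TwoSidedMarket.regret P π T ω.1 ω.2 ≤ bound ∧
              TwoSidedMarket.deployedRegret P π T ω.1 ω.2 ≤ bound} ∧
        -- the regret in expectation over the learner, over valuations
        ENNReal.ofReal (1 - 3 * δ) ≤
          (TwoSidedMarket.valuationLaw P)
            {v | ∫ u, TwoSidedMarket.regret P π T v u ∂TwoSidedMarket.learnerLaw ≤ bound ∧
              ∫ u, TwoSidedMarket.deployedRegret P π T v u ∂TwoSidedMarket.learnerLaw
                ≤ bound} := by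
  refine ⟨13 * c + 1 + 7 * (10 + 4 * c + 4 * a), a + 1, ?_⟩
  intro n _ P _ T hT δ hδ T₀ K hT₀ hK pick hpick π bound
  refine ⟨fun v u t => TwoSidedMarket.rev_nonneg T K δ pick v u t, ?_⟩
  rcases le_or_gt (1 / 3) δ with hδ' | hδ'
  · rw [ENNReal.ofReal_of_nonpos (by linarith)]
    exact ⟨zero_le, zero_le⟩
  have hT₀1 : 1 ≤ T₀ := TwoSidedMarket.pos_of_hasOrder hc hT hδ hT₀
  have hK1 : 1 ≤ K := TwoSidedMarket.pos_of_hasOrder hc hT hδ hK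
  have hT' : (1 : ℝ) ≤ T := by exact_mod_cast hT
  have hKpos : (0 : ℝ) < K := by exact_mod_cast hK1
  have hL1 : 1 ≤ TwoSidedMarket.logFactor T δ := TwoSidedMarket.one_le_logFactor T hδ
  set L := TwoSidedMarket.logFactor T δ with hL
  set l := TwoSidedMarket.confidenceLevel T T₀ K δ with hl
  set B := TwoSidedMarket.regretBound T T₀ K l with hB
  have hl0 : 1 / 4 ≤ l := TwoSidedMarket.quarter_le_confidenceLevel hδ hδ'
  have hB0 : 0 ≤ B := by
    rw [hB, TwoSidedMarket.regretBound]
    positivity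
  -- the rate
  set x : ℝ := (T : ℝ) ^ (1 / 3 : ℝ) with hx
  have hx1 : 1 ≤ x := Real.one_le_rpow hT' (by norm_num)
  have hx2 : (T : ℝ) ^ (2 / 3 : ℝ) = x ^ 2 := by
    rw [hx, ← Real.rpow_natCast, ← Real.rpow_mul (by linarith)]
    norm_num
  have hx3 : (T : ℝ) = x ^ 3 := by
    rw [hx, ← Real.rpow_natCast, ← Real.rpow_mul (by linarith)]
    norm_num
  have hy : 0 < c * L ^ a := by positivity
  obtain ⟨hT₀l, hT₀u⟩ := hT₀
  obtain ⟨hKl, hKu⟩ := hK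
  rw [hx2] at hT₀l hT₀u
  have hbound : B + T * (1 / K) ≤ bound := by
    refine (TwoSidedMarket.regretBound_add_le hx1 hy (by linarith) hx3 hT₀l hT₀u hKl hKu
      hK1).trans ?_
    have hxT : x ≤ T := by rw [hx3]; nlinarith
    have hx2T : x ^ 2 ≤ T := by rw [hx3]; nlinarith
    have hlL : l ≤ (10 + 4 * c + 4 * a) * L :=
      TwoSidedMarket.confidenceLevel_le hc hT hδ hδ' (hT₀u.trans (by gcongr))
        (hKu.trans (by gcongr))
    show _ ≤ (13 * c + 1 + 7 * (10 + 4 * c + 4 * a)) * L ^ (a + 1) * (T : ℝ) ^ (2 / 3 : ℝ)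
    rw [hx2]
    refine mul_le_mul_of_nonneg_right ?_ (by positivity)
    have h1 : L ^ a ≤ L ^ (a + 1) := pow_le_pow_right₀ hL1 (by omega)
    have h2 : L ≤ L ^ (a + 1) := le_self_pow₀ hL1 (by omega)
    have h3 : 1 ≤ L ^ (a + 1) := one_le_pow₀ hL1
    have h4 : 13 * (c * L ^ a) ≤ 13 * (c * L ^ (a + 1)) := by gcongr
    have h5 : (10 + 4 * c + 4 * a) * L ≤ (10 + 4 * c + 4 * a) * L ^ (a + 1) := by gcongr
    linarith
  have hTK0 : 0 ≤ (T : ℝ) * (1 / K) := by positivity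
  have hbad := TwoSidedMarket.measure_regret_gt_le P (pick := pick) hpick hT hT₀1 hK1 hδ hδ'
  constructor
  · refine TwoSidedMarket.ofReal_one_sub_le_measure (by linarith)
      (((measure_mono ?_).trans hbad).trans (ENNReal.ofReal_le_ofReal ?_))
    · intro ω hω hgood
      exact hω ⟨hgood.1.trans (by linarith), hgood.2.trans (by linarith)⟩
    · refine (div_le_self (by linarith) (by exact_mod_cast hK1)).trans (by linarith)
  · have hmarkov := TwoSidedMarket.measure_compl_integral_le
      (μ := TwoSidedMarket.valuationLaw P) (ν := TwoSidedMarket.learnerLaw)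
      (f := TwoSidedMarket.regret P π T) (g := TwoSidedMarket.deployedRegret P π T)
      (ε := 2 * δ) (η := 1 / K) (D := T) hB0 (by linarith) (by positivity)
      (TwoSidedMarket.integrable_regret P T T₀ K δ pick)
      (TwoSidedMarket.integrable_deployedRegret P T T₀ K δ pick)
      (TwoSidedMarket.regret_le_horizon P) (TwoSidedMarket.deployedRegret_le_horizon P)
      (hbad.trans (le_of_eq (by rw [mul_one_div])))
    refine TwoSidedMarket.ofReal_one_sub_le_measure (by linarith)
      (((measure_mono ?_).trans hmarkov).trans (ENNReal.ofReal_le_ofReal (by linarith)))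
    refine Set.compl_subset_compl.mpr fun v hv => ?_
    exact ⟨hv.1.trans hbound, hv.2.trans hbound⟩
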